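/- Let $n\ge2$ and let $L_2=L_2(\mathbb S^n)$ be the space of square-integrable real- or complex-valued functions on the unit sphere $\mathbb S^n\subset\mathbb R^{n+1}$ with respect to the surface measure $dS$, with inner product $\langle v,w\rangle=\int_{\mathbb S^n}v\overline w\,dS$ and norm $\|\cdot\|$. For each $\ell\ge0$ let $\{Y_{\ell k}\}_{k=1}^{N(n,\ell)}$ be an orthonormal basis of the space of spherical harmonics of degree $\ell$ (restrictions to $\mathbb S^n$ of harmonic homogeneous polynomials of degree $\ell$), where $N(n,\ell)$ is the dimension of that space; put $\hat v_{\ell k}=\langle v,Y_{\ell k}\rangle$ and $\lambda_\ell=\ell(\ell+n-1)$, and let $$H^1=\Bigl\{v\in L_2:\ \sum_{\ell=0}^\infty(1+\lambda_\ell)\sum_{k=1}^{N(n,\ell)}|\hat v_{\ell k}|^2<\infty\Bigr\}.$$ Let $\Delta^*$ be the Laplace--Beltrami operator, $\Delta^*v=\Delta\bigl[v(x/|x|)\bigr]\big|_{\mathbb S^n}$, extended to $H^1$ in the sense of distributions, and for $u,v\in H^1$ let $a(u,v)=\langle-\Delta^*u,v\rangle=\sum_{\ell,k}\langle u,-\Delta^*Y_{\ell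 k}\rangle\,\overline{\hat v_{\ell k}}$ and $a_1(u,v)=a(u,v)+\langle u,v\rangle$. Let $\phi:[-1,1]\to\mathbb R$ be continuous with $$\phi(t)=\frac1{\omega_n}\sum_{\ell=0}^\infty N(n,\ell)\,a_\ell P_\ell(t),\qquad c(1+\lambda_\ell)^{-\tau}\le a_\ell\le C(1+\lambda_\ell)^{-\tau}\quad(\ell\ge0),$$ for some $\tau>n/2$ and constants $c,C>0$, where $\omega_n=\int_{\mathbb S^n}dS$ and $P_\ell$ is the Legendre polynomial of degree $\ell$ for $\mathbb R^{n+1}$, normalized by $P_\ell(1)=1$. Let $X\subset\mathbb S^n$ be a finite set and let $S_h=\operatorname{span}\{y\mapsto\phi(x\cdot y):x\in X\}\subseteq H^1$. Let $P_h:L_2\to S_h$ be the $L_2$-orthogonal projector and $R_h:H^1\to S_h$ the Ritz projector, defined by $a_1(R_hv,\chi)=a_1(v,\chi)$ for all $\chi\in S_h$. Let $u_0\in L_2$. Let $u:[0,\infty)\to L_2$ be the solution of $\partial_tu-\Delta^*u=0$, $u(0)=u_0$, that is: $u$ is continuous on $[0,\infty)$ and differentiable on $(0,\infty)$ as a map into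 $L_2$, $u(0)=u_0$, and for every $t>0$ we have $u(t)\in H^1$ and $\langle\partial_tu,v\rangle+a(u,v)=0$ for all $v\in H^1$. Let $u_h:[0,\infty)\to S_h$ be the semidiscrete solution with $u_h(0)=P_hu_0$, that is: $u_h$ is continuous on $[0,\infty)$, differentiable on $(0,\infty)$, and $\langle\partial_tu_h,\chi\rangle+a(u_h,\chi)=0$ for all $t>0$ and $\chi\in S_h$. Put $\mathsf e(t)=u_h(t)-u(t)$ and, for $t>0$, $\rho(t)=(R_h-I)u(t)$. Then for every $T>0$ there is a constant $C_T>0$, depending only on $T$, such that the following holds for all data as above: $\rho$ is differentiable on $(0,\infty)$ as a map into $L_2$, and for $0<t\le T$ the function $s\mapsto s^2\|\partial_s\rho(s)\|^2+\|\rho(s)\|^2$ is integrable on $(0,t)$ and $$\|\mathsf e(t)\|^2\le C_T\biggl(\|\rho(t)\|^2+\frac1t\int_0^t\bigl(s^2\|\partial_s\rho(s)\|^2+\|\rho(s)\|^2\bigr)\,ds\biggr).$$ -/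

import Mathlib

open MeasureTheory

noncomputable section

namespace SphereHeat

/-- The unit sphere `𝕊ⁿ` in `ℝⁿ⁺¹`. -/
abbrev Sph (n : ℕ) : Type := Metric.sphere (0 : EuclideanSpace ℝ (Fin (n + 1))) 1

/-- The surface measure on `𝕊ⁿ`. -/
abbrev surf (n : ℕ) : Measure (Sph n) :=
  (volume : Measure (EuclideanSpace ℝ (Fin (n + 1)))).toSphere

/-- `L₂(𝕊ⁿ)`, with real or complex values. -/
abbrev L2 (𝕜 : Type*) [RCLike 𝕜] (n : ℕ) : Type _ := Lp 𝕜 2 (surf n)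

section

variable {𝕜 : Type*} [RCLike 𝕜] {n : ℕ}

/-- `⟨v, w⟩ = ∫ v w̄ dS`, linear in the first argument. -/
def ip (v w : L2 𝕜 n) : 𝕜 := inner 𝕜 w v

/-! ### Spherical harmonics and the Laplace--Beltrami operator -/

variable (𝕜 n) in
/-- The algebraic Laplacian on polynomials in `n + 1` variables. -/
def polyLaplacian :
    MvPolynomial (Fin (n + 1)) 𝕜 →ₗ[𝕜] MvPolynomial (Fin (n + 1)) 𝕜 :=
  ∑ i, (MvPolynomial.pderiv i).toLinearMap ∘ₗ (MvPolynomial.pderiv i).toLinearMap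

variable (𝕜 n) in
/-- Restriction of a polynomial function to the sphere. -/
def restrictSph : MvPolynomial (Fin (n + 1)) 𝕜 →ₗ[𝕜] C(Sph n, 𝕜) where
  toFun p :=
    { toFun := fun x => MvPolynomial.eval (fun i => ((x.1 i : ℝ) : 𝕜)) p
      continuous_toFun := by
        refine (MvPolynomial.continuous_eval p).comp (continuous_pi fun i => ?_)
        fun_prop }
  map_add' p q := by ext; simp
  map_smul' c p := by ext; simp [MvPolynomial.smul_eval]

variable (𝕜 n) in
/-- The space `ℋ_ℓ` of spherical harmonics of degree `ℓ`: the restrictions to the sphere of the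
harmonic homogeneous polynomials of degree `ℓ`. -/
def sphHarm (l : ℕ) : Submodule 𝕜 C(Sph n, 𝕜) :=
  (MvPolynomial.homogeneousSubmodule (Fin (n + 1)) 𝕜 l ⊓ LinearMap.ker (polyLaplacian 𝕜 n)).map
    (restrictSph 𝕜 n)

variable (𝕜 n) in
/-- `N(n, ℓ) = dim ℋ_ℓ`. -/
def harmDim (l : ℕ) : ℕ := Module.finrank 𝕜 (sphHarm 𝕜 n l)

variable (𝕜 n) in
/-- A choice, for every `ℓ`, of an orthonormal basis `Y_{ℓ k}`, `1 ≤ k ≤ N(n, ℓ)`, of `ℋ_ℓ`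
(orthonormal families of `dim ℋ_ℓ` elements of `ℋ_ℓ`). -/
structure HarmonicBasis where
  /-- the basis functions -/
  Y : (l : ℕ) → Fin (harmDim 𝕜 n l) → C(Sph n, 𝕜)
  mem : ∀ l k, Y l k ∈ sphHarm 𝕜 n l
  orthonormal : ∀ l k k',
    ∫ x, Y l k x * (starRingEnd 𝕜) (Y l k' x) ∂(surf n) = if k = k' then 1 else 0

instance (l : ℕ) : FiniteDimensional 𝕜 (sphHarm 𝕜 n l) := by
  have h : Module.Finite 𝕜 (MvPolynomial.homogeneousSubmodule (Fin (n + 1)) 𝕜 l) :=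
    Module.Finite.iff_fg.mpr (MvPolynomial.homogeneousSubmodule_fg _ _ l)
  have h2 := Submodule.finiteDimensional_of_le (K := 𝕜)
    (inf_le_left : MvPolynomial.homogeneousSubmodule (Fin (n + 1)) 𝕜 l ⊓
      LinearMap.ker (polyLaplacian 𝕜 n) ≤ _)
  exact Module.Finite.map _ _

/-- Orthonormal bases of the spaces `ℋ_ℓ` exist. -/
instance : Nonempty (HarmonicBasis 𝕜 n) := by
  let J : C(Sph n, 𝕜) →ₗ[𝕜] L2 𝕜 n := (ContinuousMap.toLp 2 (surf n) 𝕜).toLinearMap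
  have hJ : Function.Injective J := ContinuousMap.toLp_injective (surf n)
  let E (l : ℕ) := Submodule.equivMapOfInjective J hJ (sphHarm 𝕜 n l)
  have hfd (l : ℕ) : FiniteDimensional 𝕜 ((sphHarm 𝕜 n l).map J) := Module.Finite.map _ _
  have hd (l : ℕ) : Module.finrank 𝕜 ((sphHarm 𝕜 n l).map J) = harmDim 𝕜 n l :=
    (E l).symm.finrank_eq
  let b (l : ℕ) := (stdOrthonormalBasis 𝕜 ((sphHarm 𝕜 n l).map J)).reindex (finCongr (hd l))
  refine ⟨⟨fun l k => ((E l).symm (b l k)).1, fun l k => ((E l).symm (b l k)).2, ?_⟩⟩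
  intro l k k'
  have key (j) : ContinuousMap.toLp 2 (surf n) 𝕜 ((E l).symm (b l j)).1 = (b l j : L2 𝕜 n) :=
    congrArg Subtype.val ((E l).apply_symm_apply (b l j))
  have h := orthonormal_iff_ite.mp (b l).orthonormal k' k
  rw [Submodule.coe_inner, ← key k', ← key k, ContinuousMap.inner_toLp] at h
  rw [h]
  simp [eq_comm]

/-- The homogeneous extension `x ↦ v (x / |x|)` of degree zero (with value `0` at the origin). -/
def radialExt (v : Sph n → 𝕜) (x : EuclideanSpace ℝ (Fin (n + 1))) : 𝕜 :=
  if h : x ≠ 0 then v ⟨‖x‖⁻¹ • x, by simp [norm_smul, h]⟩ else 0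

/-- The Laplace--Beltrami operator: the restriction to the sphere of the Laplacian of
`x ↦ v (x / |x|)`. -/
def lapBeltrami (v : Sph n → 𝕜) (x : Sph n) : 𝕜 :=
  Laplacian.laplacian (radialExt v) x.1

variable (n) in
/-- `λ_ℓ = ℓ (ℓ + n - 1)` (written without truncated subtraction; `0` for `ℓ = 0`). -/
def eig (l : ℕ) : ℝ := (l : ℝ) * ((l : ℝ) + (n : ℝ) - 1)

/-! ### The Sobolev space `H¹` and the forms `a` and `a₁` -/

variable (B : HarmonicBasis 𝕜 n)

/-- The generalized Fourier coefficient `v̂_{ℓ k} = ⟨v, Y_{ℓ k}⟩`. -/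
def coeff (v : L2 𝕜 n) (l : ℕ) (k : Fin (harmDim 𝕜 n l)) : 𝕜 :=
  ip v (ContinuousMap.toLp 2 (surf n) 𝕜 (B.Y l k))

/-- The generalized Fourier coefficient of the distribution `A v = -Δ* v`, i.e.
`⟨A v, Y_{ℓ k}⟩ = ⟨v, -Δ* Y_{ℓ k}⟩`. -/
def coeffA (v : L2 𝕜 n) (l : ℕ) (k : Fin (harmDim 𝕜 n l)) : 𝕜 :=
  ∫ x, v x * (starRingEnd 𝕜) (-lapBeltrami (B.Y l k) x) ∂(surf n)

theorem coeff_add (v w : L2 𝕜 n) (l : ℕ) (k : Fin (harmDim 𝕜 n l)) :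
    coeff B (v + w) l k = coeff B v l k + coeff B w l k := by
  simp [coeff, ip, inner_add_right]

theorem coeff_smul (c : 𝕜) (v : L2 𝕜 n) (l : ℕ) (k : Fin (harmDim 𝕜 n l)) :
    coeff B (c • v) l k = c * coeff B v l k := by
  simp [coeff, ip, inner_smul_right]

theorem eig_nonneg (l : ℕ) : 0 ≤ eig n l := by
  rcases Nat.eq_zero_or_pos l with rfl | h
  · simp [eig]
  · have h1 : (1 : ℝ) ≤ l := by exact_mod_cast h
    have h2 : (0 : ℝ) ≤ n := Nat.cast_nonneg n
    exact mul_nonneg (by linarith) (by linarith)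

/-- `H¹(𝕊ⁿ)`: the `v ∈ L₂` with `∑_ℓ (1 + λ_ℓ) ∑_k |v̂_{ℓ k}|² < ∞`. -/
def H1 : Submodule 𝕜 (L2 𝕜 n) where
  carrier := {v | Summable fun l : ℕ => (1 + eig n l) * ∑ k, ‖coeff B v l k‖ ^ 2}
  zero_mem' := by simp [coeff, ip, summable_zero]
  add_mem' := by
    intro v w hv hw
    refine Summable.of_nonneg_of_le (fun l => ?_) (fun l => ?_) ((hv.add hw).mul_left 2)
    · have := eig_nonneg (n := n) l
      positivity
    · have h0 := eig_nonneg (n := n) l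
      have : ∑ k, ‖coeff B (v + w) l k‖ ^ 2 ≤
          2 * (∑ k, ‖coeff B v l k‖ ^ 2 + ∑ k, ‖coeff B w l k‖ ^ 2) := by
        rw [← Finset.sum_add_distrib, Finset.mul_sum]
        refine Finset.sum_le_sum fun k _ => ?_
        rw [coeff_add]
        have h1 := norm_add_le (coeff B v l k) (coeff B w l k)
        have h2 := norm_nonneg (coeff B v l k + coeff B w l k)
        nlinarith [sq_nonneg (‖coeff B v l k‖ - ‖coeff B w l k‖)]
      nlinarith
  smul_mem' := by
    intro c v hv
    refine (Summable.mul_left (‖c‖ ^ 2) hv).congr fun l => ?_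
    simp only [coeff_smul, norm_mul, mul_pow, ← Finset.mul_sum]
    ring

/-- The form `a(u, v) = ⟨A u, v⟩` on `H¹`, with `A = -Δ*`; the pairing of `A u ∈ H⁻¹` with
`v ∈ H¹` is evaluated through generalized Fourier coefficients. -/
def formA (u v : H1 B) : 𝕜 :=
  ∑' l : ℕ, ∑ k, coeffA B u l k * (starRingEnd 𝕜) (coeff B v l k)

/-- `a₁(u, v) = a(u, v) + ⟨u, v⟩`. -/
def formA1 (u v : H1 B) : 𝕜 := formA B u v + ip (u : L2 𝕜 n) (v : L2 𝕜 n)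

/-! ### Spherical radial basis functions -/

/-- The Legendre polynomials `P_ℓ` for `ℝⁿ⁺¹`, normalized by `P_ℓ(1) = 1`, through their
three-term recurrence
`(ℓ + n - 1) P_{ℓ+1}(t) = (2 ℓ + n - 1) t P_ℓ(t) - ℓ P_{ℓ-1}(t)`. -/
def legendreP (n : ℕ) : ℕ → ℝ → ℝ
  | 0, _ => 1
  | 1, t => t
  | l + 2, t =>
      ((2 * (l : ℝ) + n + 1) * t * legendreP n (l + 1) t - ((l : ℝ) + 1) * legendreP n l t)
        / ((l : ℝ) + n)

/-- The continuous function `φ` on `[-1, 1]` has Fourier--Legendre coefficients `a_ℓ` which lie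
between two positive multiples of `(1 + λ_ℓ)^(-τ)`. -/
structure IsKernel (n : ℕ) (τ : ℝ) (φ : C(Set.Icc (-1 : ℝ) 1, ℝ)) (a : ℕ → ℝ) : Prop where
  expansion : ∀ t : Set.Icc (-1 : ℝ) 1,
    HasSum (fun l : ℕ => ((surf n).real Set.univ)⁻¹ * ((harmDim ℝ n l : ℝ) * a l * legendreP n l t))
      (φ t)
  decay : ∃ c C : ℝ, 0 < c ∧ 0 < C ∧ ∀ l : ℕ,
    c * (1 + eig n l) ^ (-τ) ≤ a l ∧ a l ≤ C * (1 + eig n l) ^ (-τ)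

theorem inner_mem_Icc (x y : Sph n) : inner ℝ x.1 y.1 ∈ Set.Icc (-1 : ℝ) 1 := by
  have h := abs_real_inner_le_norm x.1 y.1
  rw [norm_eq_of_mem_sphere x, norm_eq_of_mem_sphere y, mul_one] at h
  exact abs_le.mp h

variable (𝕜) in
/-- The spherical radial basis function `y ↦ Φ(x, y) = φ(x · y)`. -/
def srbf (φ : C(Set.Icc (-1 : ℝ) 1, ℝ)) (x : Sph n) : C(Sph n, 𝕜) where
  toFun y := ((φ ⟨inner ℝ x.1 y.1, inner_mem_Icc x y⟩ : ℝ) : 𝕜)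
  continuous_toFun := by
    refine RCLike.continuous_ofReal.comp (φ.continuous.comp ?_)
    exact Continuous.subtype_mk (by fun_prop) _

variable (𝕜) in
/-- `S_h = span {Φ(x, ·) : x ∈ X}`, as a subspace of `L₂`. -/
def srbfSpace (φ : C(Set.Icc (-1 : ℝ) 1, ℝ)) (X : Finset (Sph n)) : Submodule 𝕜 (L2 𝕜 n) :=
  Submodule.span 𝕜 ((fun x => ContinuousMap.toLp 2 (surf n) 𝕜 (srbf 𝕜 φ x)) '' (X : Set (Sph n)))

instance (φ : C(Set.Icc (-1 : ℝ) 1, ℝ)) (X : Finset (Sph n)) :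
    FiniteDimensional 𝕜 (srbfSpace 𝕜 φ X) :=
  FiniteDimensional.span_of_finite 𝕜 (X.finite_toSet.image _)

/-- The Ritz projection `R_h v` of `v ∈ H¹` onto `S`: the element of `S` with
`a₁(R_h v, χ) = a₁(v, χ)` for all `χ ∈ S`. -/
def ritz (S : Submodule 𝕜 (L2 𝕜 n)) (v : H1 B) : H1 B :=
  Classical.epsilon fun w : H1 B =>
    (w : L2 𝕜 n) ∈ S ∧ ∀ χ : H1 B, (χ : L2 𝕜 n) ∈ S → formA1 B w χ = formA1 B v χ

/-! ### The continuous and the semidiscrete heat equation -/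

/-- `u : [0, ∞) → L₂` solves `∂ₜu - Δ* u = 0` for `t > 0` with `u(0) = u₀`, in the weak sense. -/
structure IsHeatSolution (u₀ : L2 𝕜 n) (u : ℝ → L2 𝕜 n) : Prop where
  continuousOn : ContinuousOn u (Set.Ici 0)
  initial : u 0 = u₀
  differentiableAt : ∀ t, 0 < t → DifferentiableAt ℝ u t
  mem_H1 : ∀ t, 0 < t → u t ∈ H1 B
  weak : ∀ t (ht : 0 < t) (v : H1 B),
    ip (deriv u t) (v : L2 𝕜 n) + formA B ⟨u t, mem_H1 t ht⟩ v = 0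

/-- `u_h : [0, ∞) → S` is the Galerkin semidiscrete solution in `S ⊆ H¹` of the same equation,
with initial value `u_{0h}`. -/
structure IsSemidiscreteSolution (S : Submodule 𝕜 (L2 𝕜 n)) (u₀h : L2 𝕜 n)
    (uh : ℝ → L2 𝕜 n) : Prop where
  continuousOn : ContinuousOn uh (Set.Ici 0)
  initial : uh 0 = u₀h
  mem : ∀ t, 0 ≤ t → uh t ∈ S
  differentiableAt : ∀ t, 0 < t → DifferentiableAt ℝ uh t
  mem_H1 : ∀ t, 0 < t → uh t ∈ H1 B
  weak : ∀ t (ht : 0 < t) (χ : H1 B), (χ : L2 𝕜 n) ∈ S →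
    ip (deriv uh t) (χ : L2 𝕜 n) + formA B ⟨uh t, mem_H1 t ht⟩ χ = 0

open Classical in
/-- `ρ(t) = (R_h - I) u(t)`, at the times with `u(t) ∈ H¹`. -/
def rho (S : Submodule 𝕜 (L2 𝕜 n)) (u : ℝ → L2 𝕜 n) (t : ℝ) : L2 𝕜 n :=
  if h : u t ∈ H1 B then (ritz B S ⟨u t, h⟩ : L2 𝕜 n) - u t else 0

end

end SphereHeat

end

/-! With `θ = u_h − R_h u`, the error splits as `e = θ + ρ`, so it suffices to bound `θ` by `ρ`. Let
`P` be the `L₂`-projection onto the discrete space, `A` the operator of the form `a` there, `g = P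
ρ` and `z = P e = θ + g`. Subtracting the two equations and using the Ritz identity `a(ρ, χ) = −⟨ρ,
χ⟩` gives `z' + A θ = g`, and `z(0) = 0` because `u_h(0) = P u₀`.

Two energy arguments close the estimate. Integrating once in time gives `θ + A Θ = G − g`, with `Θ`,
`G` the primitives of `θ`, `g`; testing with `θ` bounds `∫ ‖θ‖²` by `∫ ‖g‖²` without derivatives of
`g` (`integral_norm_sq_le_of_energy`). Testing `θ' + A θ = g − g'` with `s² θ` then bounds `t
‖θ(t)‖²`, where `g'` enters only through `s² ‖g'‖²` (`mul_norm_sq_le_of_energy`). Only positivity of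
`A` is used, so the constant depends on `T` alone.

Since `u₀` is merely in `L₂`, `ρ` may be singular at `0`, and its regularity rests on parabolic
smoothing. The coefficients of `u` decay like `exp(−λ t)`, so `u'` lies in the form domain and can
be tested against; all weighted norms are then dominated by the energy `a(u, u)`, which is
integrable because it is the derivative of `−½ ‖u‖²`. This is carried out in `semidiscrete_error`
for any orthonormal family with nonnegative eigenvalues; completeness of the family is not needed,
Bessel's inequality suffices.

The sphere enters through two facts: spherical harmonics are eigenfunctions
(`lapBeltrami_of_mem_sphHarm`), and those of different degrees are orthogonal
(`integral_sphHarm_mul_conj`). The latter is Green's identity, derived from rotation invariance of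
the surface measure. -/

open MeasureTheory

noncomputable section

namespace SphereHeat

/-! ### Polynomial functions on `ℝⁿ⁺¹` and their radial rescalings. -/

section Polynomial

variable {𝕜 : Type*} [RCLike 𝕜] {n : ℕ}

/-- The polynomial function on `ℝⁿ⁺¹` attached to `p`. -/
def polyFun (p : MvPolynomial (Fin (n + 1)) 𝕜) (y : EuclideanSpace ℝ (Fin (n + 1))) : 𝕜 :=
  MvPolynomial.eval (fun i => ((y i : ℝ) : 𝕜)) p

theorem restrictSph_apply (p : MvPolynomial (Fin (n + 1)) 𝕜) (x : Sph n) :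
    restrictSph 𝕜 n p x = polyFun p x.1 := rfl

/-- The derivative of a polynomial function. -/
def polyDeriv (p : MvPolynomial (Fin (n + 1)) 𝕜) (y : EuclideanSpace ℝ (Fin (n + 1))) :
    EuclideanSpace ℝ (Fin (n + 1)) →L[ℝ] 𝕜 :=
  ∑ i, (EuclideanSpace.proj i : EuclideanSpace ℝ (Fin (n + 1)) →L[ℝ] ℝ).smulRight
    (polyFun (MvPolynomial.pderiv i p) y)

theorem polyDeriv_apply (p : MvPolynomial (Fin (n + 1)) 𝕜)
    (y v : EuclideanSpace ℝ (Fin (n + 1))) :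
    polyDeriv p y v = ∑ i, ((v i : ℝ) : 𝕜) * polyFun (MvPolynomial.pderiv i p) y := by
  simp [polyDeriv, RCLike.real_smul_eq_coe_mul]

theorem hasFDerivAt_polyFun (p : MvPolynomial (Fin (n + 1)) 𝕜)
    (y : EuclideanSpace ℝ (Fin (n + 1))) : HasFDerivAt (polyFun p) (polyDeriv p y) y := by
  induction p using MvPolynomial.induction_on with
  | C a =>
    have : polyDeriv (MvPolynomial.C a : MvPolynomial (Fin (n + 1)) 𝕜) y = 0 := by
      ext v; simp [polyDeriv_apply, polyFun]
    rw [this]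
    have h : polyFun (MvPolynomial.C a : MvPolynomial (Fin (n + 1)) 𝕜) = fun _ => a := by
      ext; simp [polyFun]
    rw [h]
    exact hasFDerivAt_const a y
  | add p q hp hq =>
    have : polyDeriv (p + q) y = polyDeriv p y + polyDeriv q y := by
      ext v; simp [polyDeriv_apply, polyFun, mul_add, Finset.sum_add_distrib]
    rw [this]
    have h : polyFun (p + q) = fun z => polyFun p z + polyFun q z := by
      ext; simp [polyFun]
    rw [h]
    exact hp.add hq
  | mul_X p i hp =>
    have hX : HasFDerivAt (fun z : EuclideanSpace ℝ (Fin (n + 1)) => ((z i : ℝ) : 𝕜))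
        (RCLike.ofRealCLM.comp (EuclideanSpace.proj i : _ →L[ℝ] ℝ)) y :=
      (RCLike.ofRealCLM.comp (EuclideanSpace.proj i : _ →L[ℝ] ℝ)).hasFDerivAt
    have h : polyFun (p * MvPolynomial.X i) = fun z => polyFun p z * ((z i : ℝ) : 𝕜) := by
      ext; simp [polyFun]
    rw [h]
    refine (hp.mul hX).congr_fderiv ?_
    ext v
    simp only [polyDeriv_apply, polyFun, Derivation.leibniz, MvPolynomial.pderiv_X, smul_eq_mul,
      map_add, map_mul, MvPolynomial.eval_X, add_apply, smul_apply,
      ContinuousLinearMap.comp_apply, mul_add, Finset.sum_add_distrib]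
    congr 1
    · simp [Pi.single_apply, apply_ite, mul_comm]
    · rw [Finset.mul_sum]
      exact Finset.sum_congr rfl fun j _ => by ring

theorem continuous_polyFun (p : MvPolynomial (Fin (n + 1)) 𝕜) : Continuous (polyFun p) :=
  continuous_iff_continuousAt.2 fun y => (hasFDerivAt_polyFun p y).continuousAt

theorem polyFun_smul_of_isHomogeneous {p : MvPolynomial (Fin (n + 1)) 𝕜} {l : ℕ}
    (hp : p.IsHomogeneous l) (c : ℝ) (y : EuclideanSpace ℝ (Fin (n + 1))) :
    polyFun p (c • y) = c ^ l • polyFun p y := by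
  simp only [polyFun, MvPolynomial.eval_eq', RCLike.real_smul_eq_coe_mul, Finset.mul_sum]
  refine Finset.sum_congr rfl fun d hd => ?_
  have hdeg : ∑ i, d i = l := by
    have := hp (MvPolynomial.mem_support_iff.1 hd)
    rwa [Finsupp.weight_apply, Finsupp.sum_fintype _ _ (by simp), Finset.sum_congr rfl
      (fun i _ => by simp : ∀ i ∈ Finset.univ, d i • (1 : Fin (n + 1) → ℕ) i = d i)] at this
  simp only [PiLp.smul_apply, smul_eq_mul, RCLike.ofReal_mul, mul_pow, Finset.prod_mul_distrib,
    Finset.prod_pow_eq_pow_sum, hdeg, RCLike.ofReal_pow]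
  ring

/-! ### The Laplace--Beltrami operator on spherical harmonics -/

/-- A negative power of the norm times a polynomial function. -/
def radialPoly (m : ℕ) (p : MvPolynomial (Fin (n + 1)) 𝕜)
    (y : EuclideanSpace ℝ (Fin (n + 1))) : 𝕜 :=
  (‖y‖ ^ m)⁻¹ • polyFun p y

theorem hasFDerivAt_inv_norm_pow (m : ℕ) {y : EuclideanSpace ℝ (Fin (n + 1))} (hy : y ≠ 0) :
    HasFDerivAt (fun z : EuclideanSpace ℝ (Fin (n + 1)) => (‖z‖ ^ m)⁻¹)
      ((-(m : ℝ) * (‖y‖ ^ (m + 2))⁻¹) • innerSL ℝ y) y := by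
  have hy' : ‖y‖ ≠ 0 := norm_ne_zero_iff.2 hy
  have h1 : HasFDerivAt (fun z : EuclideanSpace ℝ (Fin (n + 1)) => ‖z‖)
      (‖y‖⁻¹ • innerSL ℝ y) y := by
    have h := (hasStrictFDerivAt_norm_sq y).hasFDerivAt.sqrt (by positivity)
    simp only [Real.sqrt_sq (norm_nonneg _)] at h
    refine h.congr_fderiv ?_
    ext v
    simp
    field_simp
  have h2 : HasDerivAt (fun r : ℝ => (r ^ m)⁻¹) (-(m * ‖y‖ ^ (m - 1)) / (‖y‖ ^ m) ^ 2) ‖y‖ :=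
    (hasDerivAt_pow m _).inv (by positivity)
  refine (h2.comp_hasFDerivAt y h1).congr_fderiv ?_
  rw [smul_smul]
  congr 1
  rcases m with _ | m
  · simp
  · simp only [Nat.add_sub_cancel]
    field_simp
    ring

theorem hasFDerivAt_radialPoly (m : ℕ) (p : MvPolynomial (Fin (n + 1)) 𝕜)
    {y : EuclideanSpace ℝ (Fin (n + 1))} (hy : y ≠ 0) :
    HasFDerivAt (radialPoly m p) ((‖y‖ ^ m)⁻¹ • polyDeriv p y +
      ((-(m : ℝ) * (‖y‖ ^ (m + 2))⁻¹) • innerSL ℝ y).smulRight (polyFun p y)) y :=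
  (hasFDerivAt_inv_norm_pow m hy).smul (hasFDerivAt_polyFun p y)

/-- Partial derivatives of functions `|y|⁻ᵐ p(y)` are combinations of functions of the same shape,
so second derivatives follow by applying this formula twice. -/
theorem fderiv_radialPoly_single (m : ℕ) (p : MvPolynomial (Fin (n + 1)) 𝕜)
    {y : EuclideanSpace ℝ (Fin (n + 1))} (hy : y ≠ 0) (i : Fin (n + 1)) :
    fderiv ℝ (radialPoly m p) y (EuclideanSpace.single i 1) =
      radialPoly m (MvPolynomial.pderiv i p) y
        - (m : 𝕜) * radialPoly (m + 2) (MvPolynomial.X i * p) y := by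
  rw [(hasFDerivAt_radialPoly m p hy).fderiv]
  simp [radialPoly, polyDeriv_apply, polyFun, RCLike.real_smul_eq_coe_mul,
    EuclideanSpace.inner_single_right]
  ring

theorem contDiff_polyFun (p : MvPolynomial (Fin (n + 1)) 𝕜) : ContDiff ℝ 2 (polyFun p) := by
  induction p using MvPolynomial.induction_on with
  | C a =>
    have h : polyFun (MvPolynomial.C a : MvPolynomial (Fin (n + 1)) 𝕜) = fun _ => a := by
      ext; simp [polyFun]
    rw [h]
    exact contDiff_const
  | add p q hp hq =>
    have h : polyFun (p + q) = fun z => polyFun p z + polyFun q z := by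
      ext; simp [polyFun]
    rw [h]
    exact hp.add hq
  | mul_X p i hp =>
    have : ContDiff ℝ 2 (fun z : EuclideanSpace ℝ (Fin (n + 1)) => ((z i : ℝ) : 𝕜)) :=
      (RCLike.ofRealCLM (K := 𝕜)).contDiff.comp
        (EuclideanSpace.proj i : EuclideanSpace ℝ (Fin (n + 1)) →L[ℝ] ℝ).contDiff
    have h : polyFun (p * MvPolynomial.X i) = fun z => polyFun p z * ((z i : ℝ) : 𝕜) := by
      ext; simp [polyFun]
    rw [h]
    exact hp.mul this

theorem contDiffAt_radialPoly (m : ℕ) (p : MvPolynomial (Fin (n + 1)) 𝕜)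
    {y : EuclideanSpace ℝ (Fin (n + 1))} (hy : y ≠ 0) : ContDiffAt ℝ 2 (radialPoly m p) y :=
  (((contDiffAt_norm ℝ hy).pow m).inv (by positivity)).smul (contDiff_polyFun p).contDiffAt

/-- On the unit sphere the second derivatives sum to `Δp − 2l (y·∇p) − (n+1) l p + l (l+2) |y|² p`.
With `Δp = 0` and Euler's identity `y·∇p = l p` this is `−l (l+n−1) p`. -/
theorem laplacian_radialPoly {p : MvPolynomial (Fin (n + 1)) 𝕜} {l : ℕ}
    (hp : p.IsHomogeneous l) (hΔ : polyLaplacian 𝕜 n p = 0)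
    {y : EuclideanSpace ℝ (Fin (n + 1))} (hy : ‖y‖ = 1) :
    Laplacian.laplacian (radialPoly l p) y = -((eig n l : ℝ) : 𝕜) * polyFun p y := by
  have hy0 : y ≠ 0 := by rintro rfl; simp at hy
  have hev : ∀ᶠ z in nhds y, z ≠ 0 := isOpen_ne.mem_nhds hy0
  rw [InnerProductSpace.laplacian_eq_iteratedFDeriv_orthonormalBasis _
    (EuclideanSpace.basisFun (Fin (n + 1)) ℝ)]
  have hterm (i : Fin (n + 1)) : iteratedFDeriv ℝ 2 (radialPoly l p) y
      ![EuclideanSpace.basisFun (Fin (n + 1)) ℝ i, EuclideanSpace.basisFun (Fin (n + 1)) ℝ i] =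
      polyFun (MvPolynomial.pderiv i (MvPolynomial.pderiv i p)) y
        - 2 * (l : 𝕜) * (((y i : ℝ) : 𝕜) * polyFun (MvPolynomial.pderiv i p) y)
        - (l : 𝕜) * polyFun p y
        + (l : 𝕜) * ((l : 𝕜) + 2) * ((((y i) ^ 2 : ℝ) : 𝕜) * polyFun p y) := by
    simp only [EuclideanSpace.basisFun_apply]
    rw [iteratedFDeriv_two_apply]
    simp only [Matrix.cons_val_zero, Matrix.cons_val_one]
    have hd : DifferentiableAt ℝ (fderiv ℝ (radialPoly l p)) y :=
      ((contDiffAt_radialPoly l p hy0).fderiv_right (m := 1) (by norm_num)).differentiableAt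
        (by norm_num)
    have h1 := (hd.hasFDerivAt.clm_apply
      (hasFDerivAt_const (EuclideanSpace.single i (1 : ℝ)) y)).fderiv
    have h2 : (fun z => fderiv ℝ (radialPoly l p) z (EuclideanSpace.single i 1)) =ᶠ[nhds y]
        fun z => radialPoly l (MvPolynomial.pderiv i p) z
          - (l : 𝕜) * radialPoly (l + 2) (MvPolynomial.X i * p) z :=
      hev.mono fun z hz => fderiv_radialPoly_single l p hz i
    have h3 := fderiv_radialPoly_single l (MvPolynomial.pderiv i p) hy0 i
    have h4 := fderiv_radialPoly_single (l + 2) (MvPolynomial.X i * p) hy0 i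
    have h5 := h2.fderiv_eq (𝕜 := ℝ)
    rw [h1, fderiv_fun_sub ((contDiffAt_radialPoly _ _ hy0).differentiableAt (by norm_num))
      (((contDiffAt_radialPoly _ _ hy0).differentiableAt (by norm_num)).const_mul _),
      fderiv_const_mul ((contDiffAt_radialPoly _ _ hy0).differentiableAt (by norm_num))] at h5
    have h6 := congrArg (fun M : EuclideanSpace ℝ (Fin (n + 1)) →L[ℝ] 𝕜 => M (EuclideanSpace.single i (1 : ℝ))) h5
    simp [h3, h4, radialPoly, hy] at h6
    rw [h6]
    simp [polyFun]
    ring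
  simp only [hterm, Finset.sum_add_distrib, Finset.sum_sub_distrib, ← Finset.mul_sum,
    ← Finset.sum_mul]
  have hE : ∑ i, ((y i : ℝ) : 𝕜) * polyFun (MvPolynomial.pderiv i p) y = l * polyFun p y := by
    have := congrArg (fun q => polyFun q y) hp.sum_X_mul_pderiv
    simpa [polyFun] using this
  have hL : ∑ i, polyFun (MvPolynomial.pderiv i (MvPolynomial.pderiv i p)) y = 0 := by
    have := congrArg (fun q => polyFun q y) hΔ
    simpa [polyFun, polyLaplacian] using this
  have hN : ∑ i, (((y i) ^ 2 : ℝ) : 𝕜) = 1 := by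
    have := EuclideanSpace.real_norm_sq_eq y
    rw [hy] at this
    rw [← RCLike.ofReal_sum, ← this]
    simp
  rw [hE, hL, hN]
  simp [eig]
  ring

theorem radialExt_restrictSph {p : MvPolynomial (Fin (n + 1)) 𝕜} {l : ℕ}
    (hp : p.IsHomogeneous l) {y : EuclideanSpace ℝ (Fin (n + 1))} (hy : y ≠ 0) :
    radialExt (restrictSph 𝕜 n p) y = radialPoly l p y := by
  rw [radialExt, dif_pos hy, restrictSph_apply, polyFun_smul_of_isHomogeneous hp, radialPoly,
    inv_pow]

/-- Spherical harmonics of degree `l` are eigenfunctions of the Laplace--Beltrami operator. -/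
theorem lapBeltrami_of_mem_sphHarm {l : ℕ} {f : C(Sph n, 𝕜)} (hf : f ∈ sphHarm 𝕜 n l)
    (x : Sph n) : lapBeltrami f x = -((eig n l : ℝ) : 𝕜) * f x := by
  obtain ⟨p, ⟨hp, hΔ⟩, rfl⟩ := hf
  have hx : x.1 ≠ 0 := ne_zero_of_mem_unit_sphere x
  have hev : radialExt (restrictSph 𝕜 n p) =ᶠ[nhds x.1] radialPoly l p :=
    Filter.mem_of_superset (isOpen_ne.mem_nhds hx) fun _ hz => radialExt_restrictSph hp hz
  rw [lapBeltrami, (InnerProductSpace.laplacian_congr_nhds hev).self_of_nhds,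
    laplacian_radialPoly hp hΔ (norm_eq_of_mem_sphere x), restrictSph_apply]

end Polynomial

section Orthogonality

open scoped Pointwise

variable {𝕜 : Type*} [RCLike 𝕜] {n : ℕ}

/-! ### Rotation invariance and orthogonality of spherical harmonics -/

/-- The action of a linear isometry on the sphere. -/
def sphMap (R : EuclideanSpace ℝ (Fin (n + 1)) ≃ₗᵢ[ℝ] EuclideanSpace ℝ (Fin (n + 1)))
    (x : Sph n) : Sph n :=
  ⟨R x.1, by simp⟩

theorem continuous_sphMap
    (R : EuclideanSpace ℝ (Fin (n + 1)) ≃ₗᵢ[ℝ] EuclideanSpace ℝ (Fin (n + 1))) :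
    Continuous (sphMap R) :=
  Continuous.subtype_mk (R.continuous.comp continuous_subtype_val) _

/-- The surface measure of a set is a multiple of the volume of the truncated cone over it; a linear
isometry maps such cones to cones and preserves volume. -/
theorem measurePreserving_sphMap
    (R : EuclideanSpace ℝ (Fin (n + 1)) ≃ₗᵢ[ℝ] EuclideanSpace ℝ (Fin (n + 1))) :
    MeasurePreserving (sphMap R) (surf n) (surf n) := by
  have hc := continuous_sphMap R
  refine ⟨hc.measurable, Measure.ext fun s hs => ?_⟩
  rw [Measure.map_apply hc.measurable hs, Measure.toSphere_apply' _ (hc.measurable hs),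
    Measure.toSphere_apply' _ hs]
  congr 1
  have hset : Set.Ioo (0 : ℝ) 1 • ((↑) '' (sphMap R ⁻¹' s) : Set (EuclideanSpace ℝ (Fin (n + 1))))
      = R ⁻¹' (Set.Ioo (0 : ℝ) 1 • ((↑) '' s)) := by
    ext z
    simp only [Set.mem_smul, Set.mem_image, Set.mem_preimage]
    constructor
    · rintro ⟨r, hr, _, ⟨x, hx, rfl⟩, rfl⟩
      exact ⟨r, hr, _, ⟨_, hx, rfl⟩, by simp [sphMap]⟩
    · rintro ⟨r, hr, _, ⟨x, hx, rfl⟩, h⟩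
      refine ⟨r, hr, R.symm x.1, ⟨sphMap R.symm x, ?_, rfl⟩, ?_⟩
      · simpa [sphMap] using hx
      · apply R.injective
        rw [← h]
        simp
  rw [hset]
  exact R.measurePreserving.measure_preimage_equiv (f := R.toMeasurableEquiv) _

/-- The integral of a polynomial over the sphere. -/
def sphInt (p : MvPolynomial (Fin (n + 1)) 𝕜) : 𝕜 := ∫ x, polyFun p x.1 ∂(surf n)

theorem integrable_of_continuous {f : Sph n → 𝕜} (hf : Continuous f) : Integrable f (surf n) :=
  hf.integrable_of_hasCompactSupport (HasCompactSupport.of_compactSpace f)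

theorem sphInt_add (p q : MvPolynomial (Fin (n + 1)) 𝕜) :
    sphInt (p + q) = sphInt p + sphInt q := by
  have h (p : MvPolynomial (Fin (n + 1)) 𝕜) :
      Integrable (fun x : Sph n => polyFun p x.1) (surf n) :=
    integrable_of_continuous ((continuous_polyFun p).comp continuous_subtype_val)
  rw [sphInt, sphInt, sphInt, ← integral_add (h p) (h q)]
  simp [polyFun]

theorem sphInt_C_mul (c : 𝕜) (p : MvPolynomial (Fin (n + 1)) 𝕜) :
    sphInt (MvPolynomial.C c * p) = c * sphInt p := by
  rw [sphInt, sphInt, ← integral_const_mul]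
  simp [polyFun]

variable (𝕜 n) in
/-- `sphInt` as a linear map. -/
def sphIntₗ : MvPolynomial (Fin (n + 1)) 𝕜 →ₗ[𝕜] 𝕜 where
  toFun := sphInt
  map_add' := sphInt_add
  map_smul' c p := by rw [MvPolynomial.smul_eq_C_mul, sphInt_C_mul]; rfl

theorem sphIntₗ_apply (p : MvPolynomial (Fin (n + 1)) 𝕜) : sphIntₗ 𝕜 n p = sphInt p := rfl

/-- The flow is `exp(s K)`, which is unitary because `K` is skew-adjoint. -/
theorem exists_isometry_flow {E : Type*} [NormedAddCommGroup E] [InnerProductSpace ℝ E]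
    [CompleteSpace E] {K : E →L[ℝ] E} (hK : K ∈ skewAdjoint (E →L[ℝ] E)) :
    ∃ R : ℝ → E ≃ₗᵢ[ℝ] E, (∀ x, R 0 x = x) ∧
      ∀ s x, HasDerivAt (fun r => R r x) (K (R s x)) s := by
  let U (s : ℝ) : unitary (E →L[ℝ] E) :=
    ⟨NormedSpace.exp (s • K), by
      let : NormedAlgebra ℚ (E →L[ℝ] E) := NormedAlgebra.restrictScalars ℚ ℝ _
      exact NormedSpace.exp_mem_unitary_of_mem_skewAdjoint (skewAdjoint.smul_mem s hK)⟩
  have hR (s : ℝ) (x : E) :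
      Unitary.linearIsometryEquiv (U s) x = NormedSpace.exp (s • K) x := rfl
  refine ⟨fun s => Unitary.linearIsometryEquiv (U s), fun x => ?_, fun s x => ?_⟩
  · rw [hR, zero_smul, NormedSpace.exp_zero]
    rfl
  · simp only [hR]
    have h := (hasDerivAt_exp_smul_const' K s).clm_apply (hasDerivAt_const s x)
    rw [map_zero, add_zero] at h
    exact h

/-- The integral of `p ∘ R_s` does not depend on `s`, by rotation invariance; its derivative at `s =
0`, taken under the integral sign, is the integral in question. Compactness of the sphere supplies
the dominating constant. -/
theorem integral_polyDeriv_skew (p : MvPolynomial (Fin (n + 1)) 𝕜)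
    {K : EuclideanSpace ℝ (Fin (n + 1)) →L[ℝ] EuclideanSpace ℝ (Fin (n + 1))}
    (hK : K ∈ skewAdjoint (EuclideanSpace ℝ (Fin (n + 1)) →L[ℝ] EuclideanSpace ℝ (Fin (n + 1)))) :
    ∫ x : Sph n, polyDeriv p x.1 (K x.1) ∂(surf n) = 0 := by
  obtain ⟨R, hR0, hR⟩ := exists_isometry_flow hK
  have hcont : Continuous fun y : Sph n => polyDeriv p y.1 (K y.1) := by
    simp only [polyDeriv_apply]
    refine continuous_finsetSum _ fun i _ => Continuous.mul ?_
      ((continuous_polyFun _).comp continuous_subtype_val)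
    exact RCLike.continuous_ofReal.comp
      ((EuclideanSpace.proj i : _ →L[ℝ] ℝ).continuous.comp (K.continuous.comp continuous_subtype_val))
  have hp : Continuous fun y : Sph n => polyFun p y.1 :=
    (continuous_polyFun p).comp continuous_subtype_val
  obtain ⟨M, hM⟩ := (isCompact_range hcont).isBounded.exists_norm_le
  have hder (s : ℝ) (x : Sph n) : HasDerivAt (fun s => polyFun p (R s x.1))
      (polyDeriv p (R s x.1) (K (R s x.1))) s :=
    (hasFDerivAt_polyFun p _).comp_hasDerivAt s (hR s x.1)
  have hint := (hasDerivAt_integral_of_dominated_loc_of_deriv_le (μ := surf n) (x₀ := (0 : ℝ))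
    (bound := fun _ => M) (F := fun s (x : Sph n) => polyFun p (sphMap (R s) x).1)
    (F' := fun s (x : Sph n) => polyDeriv p (sphMap (R s) x).1 (K (sphMap (R s) x).1))
    Filter.univ_mem
    (.of_forall fun s => (hp.comp (continuous_sphMap (R s))).aestronglyMeasurable)
    (integrable_of_continuous (hp.comp (continuous_sphMap (R 0))))
    (hcont.comp (continuous_sphMap (R 0))).aestronglyMeasurable
    (.of_forall fun x s _ => hM _ ⟨sphMap (R s) x, rfl⟩) (integrable_const M)
    (.of_forall fun x s _ => hder s x)).2
  have hconst (s : ℝ) : ∫ x, polyFun p (sphMap (R s) x).1 ∂(surf n) =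
      ∫ x, polyFun p x.1 ∂(surf n) := by
    conv_rhs => rw [← (measurePreserving_sphMap (R s)).map_eq]
    rw [integral_map (continuous_sphMap (R s)).aemeasurable hp.aestronglyMeasurable]
  simp only [hconst] at hint
  have h0 := hint.unique (hasDerivAt_const _ _)
  simpa [sphMap, hR0] using h0

/-- Rotation invariance of the integral over the sphere, in infinitesimal form. -/
theorem sphInt_X_mul_pderiv_comm (p : MvPolynomial (Fin (n + 1)) 𝕜) (i j : Fin (n + 1)) :
    sphInt (MvPolynomial.X i * MvPolynomial.pderiv j p) =
      sphInt (MvPolynomial.X j * MvPolynomial.pderiv i p) := by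
  let P (i : Fin (n + 1)) : EuclideanSpace ℝ (Fin (n + 1)) →L[ℝ] ℝ := EuclideanSpace.proj i
  -- The infinitesimal rotation in the `(i, j)`-plane: differentiating `p` along `K x` gives `x_i
  -- ∂_j p − x_j ∂_i p`.
  let K : EuclideanSpace ℝ (Fin (n + 1)) →L[ℝ] EuclideanSpace ℝ (Fin (n + 1)) :=
    (P i).smulRight (EuclideanSpace.single j 1) - (P j).smulRight (EuclideanSpace.single i 1)
  have hKa (x : EuclideanSpace ℝ (Fin (n + 1))) :
      K x = x i • EuclideanSpace.single j 1 - x j • EuclideanSpace.single i 1 := rfl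
  have hK : K ∈ skewAdjoint (EuclideanSpace ℝ (Fin (n + 1)) →L[ℝ] _) := by
    rw [skewAdjoint.mem_iff, ContinuousLinearMap.star_eq_adjoint, eq_comm,
      ContinuousLinearMap.eq_adjoint_iff]
    intro x y
    simp only [hKa, neg_apply, inner_neg_left, inner_sub_left, inner_sub_right,
      inner_smul_left, inner_smul_right, EuclideanSpace.inner_single_left,
      EuclideanSpace.inner_single_right]
    simp
    ring
  have h := integral_polyDeriv_skew p hK
  have hpd (x : Sph n) : polyDeriv p x.1 (K x.1) =
      polyFun (MvPolynomial.X i * MvPolynomial.pderiv j p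
        + MvPolynomial.C (-1) * (MvPolynomial.X j * MvPolynomial.pderiv i p)) x.1 := by
    rw [hKa, map_sub, map_smul, map_smul]
    simp [polyDeriv_apply, polyFun, RCLike.real_smul_eq_coe_mul]
    ring
  simp only [hpd] at h
  change sphInt _ = 0 at h
  rw [sphInt_add, sphInt_C_mul] at h
  linear_combination h

theorem sphInt_norm_sq_mul (p : MvPolynomial (Fin (n + 1)) 𝕜) :
    sphInt ((∑ j, MvPolynomial.X j * MvPolynomial.X j) * p) = sphInt p := by
  refine integral_congr_ae (.of_forall fun x => ?_)
  have h : ∑ j, ((x.1 j : ℝ) : 𝕜) * ((x.1 j : ℝ) : 𝕜) = 1 := by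
    have := EuclideanSpace.real_norm_sq_eq x.1
    rw [norm_eq_of_mem_sphere x] at this
    rw [← Finset.sum_congr rfl fun j _ => RCLike.ofReal_mul _ _, ← RCLike.ofReal_sum,
      ← Finset.sum_congr rfl fun j _ => pow_two (x.1 j), ← this]
    simp
  simp [polyFun, h]

open MvPolynomial in
/-- The divergence theorem for vector fields with components homogeneous of degree `d`. -/
theorem sphInt_divergence (F : Fin (n + 1) → MvPolynomial (Fin (n + 1)) 𝕜) (d : 𝕜)
    (hF : ∀ i, ∑ j, X j * pderiv j (F i) = C d * F i) :
    ((n : 𝕜) + d) * sphInt (∑ i, X i * F i) = sphInt (∑ i, pderiv i (F i)) := by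
  -- Exchange `i` and `j` in the identity for `X_j F_i` and sum. One side collapses by Euler's
  -- identity to `(n+1+d) x·F`, the other is `x·F + |x|² div F`, with `|x| = 1` on the sphere.
  have h : sphInt (∑ i, ∑ j, X i * pderiv j (X j * F i)) =
      sphInt (∑ i, ∑ j, X j * pderiv i (X j * F i)) := by
    simp only [← sphIntₗ_apply, map_sum]
    exact Finset.sum_congr rfl fun i _ => Finset.sum_congr rfl fun j _ =>
      sphInt_X_mul_pderiv_comm _ _ _
  have h1 : ∑ i, ∑ j, X i * pderiv j (X j * F i) =
      C ((n : 𝕜) + 1 + d) * ∑ i, X i * F i := by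
    rw [Finset.mul_sum]
    refine Finset.sum_congr rfl fun i _ => ?_
    rw [← Finset.mul_sum]
    simp only [Derivation.leibniz, pderiv_X_self, smul_eq_mul, mul_one, Finset.sum_add_distrib, hF]
    simp
    ring
  have h2 : ∑ i, ∑ j, X j * pderiv i (X j * F i) =
      ∑ i, X i * F i + (∑ j, X j * X j) * ∑ i, pderiv i (F i) := by
    rw [Finset.mul_sum, ← Finset.sum_add_distrib]
    refine Finset.sum_congr rfl fun i _ => ?_
    simp only [Derivation.leibniz, pderiv_X, smul_eq_mul, mul_add, Finset.sum_add_distrib,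
      Finset.sum_mul]
    refine (add_comm _ _).trans (congrArg₂ _ ?_ ?_)
    · simp [Pi.single_apply]
    · exact Finset.sum_congr rfl fun j _ => by ring
  rw [h1, h2, sphInt_C_mul, sphInt_add, sphInt_norm_sq_mul] at h
  linear_combination h

open MvPolynomial in
theorem sum_X_mul_pderiv_pderiv {q : MvPolynomial (Fin (n + 1)) 𝕜} {m : ℕ}
    (hq : q.IsHomogeneous m) (i : Fin (n + 1)) :
    ∑ j, X j * pderiv j (pderiv i q) = C ((m : 𝕜) - 1) * pderiv i q := by
  rw [(hq.pderiv (i := i)).sum_X_mul_pderiv]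
  rcases m with _ | m
  -- In degree `0` the truncated degree of the derivative is not `m − 1`, but the derivative
  -- vanishes.
  · have : pderiv i q = 0 := by
      rw [totalDegree_eq_zero_iff_eq_C.1 (Nat.le_zero.1 hq.totalDegree_le), pderiv_C]
    simp [this]
  · simp

open MvPolynomial in
/-- Harmonic homogeneous polynomials of different degrees are orthogonal on the sphere. -/
theorem sphInt_mul_eq_zero {p q : MvPolynomial (Fin (n + 1)) 𝕜} {l m : ℕ} (hn : 1 ≤ n)
    (hp : p.IsHomogeneous l) (hq : q.IsHomogeneous m)
    (hΔp : polyLaplacian 𝕜 n p = 0) (hΔq : polyLaplacian 𝕜 n q = 0) (hlm : l ≠ m) :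
    sphInt (p * q) = 0 := by
  have hEp := hp.sum_X_mul_pderiv
  have hEq := hq.sum_X_mul_pderiv
  -- Green's identity: the field `p ∇q − q ∇p` is divergence free for harmonic `p`, `q`, and its
  -- radial component is `(m − l) p q`.
  have h := sphInt_divergence (fun i => p * pderiv i q - q * pderiv i p) ((l : 𝕜) + m - 1) ?_
  · have h1 : ∑ i, X i * (p * pderiv i q - q * pderiv i p) = C ((m : 𝕜) - l) * (p * q) := by
      have : ∑ i, X i * (p * pderiv i q - q * pderiv i p) =
          p * ∑ i, X i * pderiv i q - q * ∑ i, X i * pderiv i p := by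
        rw [Finset.mul_sum, Finset.mul_sum, ← Finset.sum_sub_distrib]
        exact Finset.sum_congr rfl fun i _ => by ring
      rw [this, hEp, hEq]
      simp
      ring
    have h2 : ∑ i, pderiv i (p * pderiv i q - q * pderiv i p) = 0 := by
      have : ∑ i, pderiv i (p * pderiv i q - q * pderiv i p) =
          p * polyLaplacian 𝕜 n q - q * polyLaplacian 𝕜 n p := by
        simp only [polyLaplacian, LinearMap.sum_apply, LinearMap.comp_apply]
        rw [Finset.mul_sum, Finset.mul_sum, ← Finset.sum_sub_distrib]
        refine Finset.sum_congr rfl fun i _ => ?_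
        simp only [map_sub, Derivation.leibniz, smul_eq_mul, Derivation.coeFn_coe]
        ring
      rw [this, hΔp, hΔq]
      simp
    rw [h1, h2, sphInt_C_mul] at h
    have h3 : (m : 𝕜) - l ≠ 0 := sub_ne_zero.2 (by exact_mod_cast hlm.symm)
    -- Positive since `n ≥ 1` and `l ≠ m` forces `l + m ≥ 1`.
    have h4 : (n : 𝕜) + ((l : 𝕜) + m - 1) ≠ 0 := by
      have : (n : 𝕜) + ((l : 𝕜) + m - 1) = ((n - 1 + l + m : ℕ) : 𝕜) := by
        push_cast [hn]; ring
      rw [this]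
      exact Nat.cast_ne_zero.2 (by omega)
    have h0 : sphInt (0 : MvPolynomial (Fin (n + 1)) 𝕜) = 0 := map_zero (sphIntₗ 𝕜 n)
    rw [h0] at h
    simpa [h3, h4] using h
  · intro i
    have e1 := sum_X_mul_pderiv_pderiv hq i
    have e2 := sum_X_mul_pderiv_pderiv hp i
    have : ∑ j, X j * pderiv j (p * pderiv i q - q * pderiv i p) =
        p * ∑ j, X j * pderiv j (pderiv i q) + pderiv i q * ∑ j, X j * pderiv j p
        - q * ∑ j, X j * pderiv j (pderiv i p) - pderiv i p * ∑ j, X j * pderiv j q := by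
      simp only [Finset.mul_sum]
      rw [← Finset.sum_add_distrib, ← Finset.sum_sub_distrib, ← Finset.sum_sub_distrib]
      refine Finset.sum_congr rfl fun j _ => ?_
      simp only [map_sub, Derivation.leibniz, smul_eq_mul]
      ring
    rw [this, e1, e2, hEp, hEq]
    simp
    ring

/-- At real points, conjugating a polynomial's value amounts to conjugating its coefficients. This
preserves homogeneity and harmonicity, so the bilinear orthogonality applies. -/
theorem integral_sphHarm_mul_conj {l m : ℕ} (hn : 1 ≤ n) (hlm : l ≠ m) {f g : C(Sph n, 𝕜)}
    (hf : f ∈ sphHarm 𝕜 n l) (hg : g ∈ sphHarm 𝕜 n m) :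
    ∫ x, f x * (starRingEnd 𝕜) (g x) ∂(surf n) = 0 := by
  obtain ⟨p, ⟨hp, hΔp⟩, rfl⟩ := hf
  obtain ⟨q, ⟨hq, hΔq⟩, rfl⟩ := hg
  have hΔ : polyLaplacian 𝕜 n (MvPolynomial.map (starRingEnd 𝕜) q) = 0 := by
    have h : polyLaplacian 𝕜 n (MvPolynomial.map (starRingEnd 𝕜) q) =
        MvPolynomial.map (starRingEnd 𝕜) (polyLaplacian 𝕜 n q) := by
      simp [polyLaplacian, MvPolynomial.pderiv_map]
    rw [h, hΔq, map_zero]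
  rw [← sphInt_mul_eq_zero hn hp (MvPolynomial.IsHomogeneous.map hq (starRingEnd 𝕜)) hΔp hΔ hlm]
  refine integral_congr_ae (.of_forall fun x => ?_)
  simp only [restrictSph_apply, polyFun, map_mul, MvPolynomial.eval_map]
  congr 1
  rw [MvPolynomial.eval, MvPolynomial.coe_eval₂Hom, MvPolynomial.hom_eval₂]
  congr 1
  ext i
  simp

end Orthogonality

section Energy

open Set intervalIntegral

/-! ### The energy estimate -/

/-! ### Integrability and the Cauchy–Schwarz inequality on `(0, t]`. -/

section Real

variable {F : Type*} [NormedAddCommGroup F] {f : ℝ → F} {t : ℝ}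

theorem aestronglyMeasurable_uIoc_of_continuousOn_Ioi {f : ℝ → F} (hf : ContinuousOn f (Ioi 0))
    (ht : 0 < t) : AEStronglyMeasurable f (volume.restrict (uIoc 0 t)) := by
  rw [uIoc_of_le ht.le]
  exact (hf.mono fun s hs => hs.1).aestronglyMeasurable measurableSet_Ioc

theorem intervalIntegrable_of_le_on_Ioc {f : ℝ → F} {b : ℝ → ℝ}
    (hf : AEStronglyMeasurable f (volume.restrict (uIoc 0 t))) (ht : 0 < t)
    (hb : IntervalIntegrable b volume 0 t) (h : ∀ s ∈ Ioc 0 t, ‖f s‖ ≤ b s) :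
    IntervalIntegrable f volume 0 t := by
  refine hb.mono_fun' hf ?_
  rw [uIoc_of_le ht.le]
  exact (ae_restrict_iff' measurableSet_Ioc).2 (.of_forall h)

theorem intervalIntegrable_of_sq (hf : ContinuousOn f (Ioi 0)) (ht : 0 < t)
    (h : IntervalIntegrable (fun s => ‖f s‖ ^ 2) volume 0 t) :
    IntervalIntegrable f volume 0 t := by
  refine intervalIntegrable_of_le_on_Ioc (aestronglyMeasurable_uIoc_of_continuousOn_Ioi hf ht) ht
    ((intervalIntegrable_const (c := (1 : ℝ))).add h) fun s _ => ?_
  nlinarith [sq_nonneg (‖f s‖ - 1), norm_nonneg (f s)]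

/-- Cauchy–Schwarz, from nonnegativity of the variance of `‖f‖` about its mean `J / t`. -/
theorem norm_sq_integral_le [NormedSpace ℝ F] (ht : 0 < t) (hi : IntervalIntegrable f volume 0 t)
    (h : IntervalIntegrable (fun s => ‖f s‖ ^ 2) volume 0 t) :
    ‖∫ s in (0 : ℝ)..t, f s‖ ^ 2 ≤ t * ∫ s in (0 : ℝ)..t, ‖f s‖ ^ 2 := by
  have h1 := norm_integral_le_integral_norm (f := f) (μ := volume) ht.le
  set J := ∫ s in (0 : ℝ)..t, ‖f s‖
  have h2 : 0 ≤ ∫ s in (0 : ℝ)..t, (‖f s‖ ^ 2 - (2 * (J / t)) * ‖f s‖ + (J / t) ^ 2) :=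
    integral_nonneg ht.le fun s _ => by nlinarith [sq_nonneg (‖f s‖ - J / t)]
  rw [integral_add (h.sub (hi.norm.const_mul _)) intervalIntegrable_const,
    integral_sub h (hi.norm.const_mul _), intervalIntegral.integral_const_mul,
    intervalIntegral.integral_const] at h2
  have h3 : t * ((∫ s in (0 : ℝ)..t, ‖f s‖ ^ 2) - 2 * (J / t) * J + (t - 0) • (J / t) ^ 2) =
      t * (∫ s in (0 : ℝ)..t, ‖f s‖ ^ 2) - J ^ 2 := by
    simp only [smul_eq_mul, sub_zero]
    field_simp
    ring
  have h4 := mul_nonneg ht.le h2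
  rw [h3] at h4
  nlinarith [norm_nonneg (∫ s in (0 : ℝ)..t, f s)]

end Real

theorem hasDerivAt_norm_sq (𝕜 : Type*) [RCLike 𝕜] {F : Type*} [NormedAddCommGroup F]
    [InnerProductSpace 𝕜 F] [NormedSpace ℝ F] {f : ℝ → F} {f' : F} {s : ℝ} (hf : HasDerivAt f f' s) :
    HasDerivAt (fun r => ‖f r‖ ^ 2) (2 * RCLike.re (inner 𝕜 (f s) f')) s := by
  have h := (RCLike.reCLM (K := 𝕜)).hasFDerivAt.comp_hasDerivAt s (hf.inner 𝕜 hf)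
  have e : (RCLike.reCLM ∘ fun r => inner 𝕜 (f r) (f r)) = fun r => ‖f r‖ ^ 2 := by
    ext r; simp
  rw [e] at h
  refine h.congr_deriv ?_
  simp only [RCLike.reCLM_apply, map_add]
  rw [inner_re_symm f' (f s)]
  ring

variable {𝕜 : Type*} [RCLike 𝕜] {F : Type*} [NormedAddCommGroup F] [InnerProductSpace 𝕜 F]
  [NormedSpace ℝ F] [IsScalarTower ℝ 𝕜 F] [CompleteSpace F] {A : F →L[𝕜] F} {θ g z : ℝ → F} {t T : ℝ}

/-- If `z = θ + g` solves `z' + A θ = g`, `z(0) = 0`, then `θ` is bounded by `g` in `L₂(0, t)`. -/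
theorem integral_norm_sq_le_of_energy (hA : A.IsPositive) (ht : 0 < t)
    (hθc : ContinuousOn θ (Ioi 0)) (hgc : ContinuousOn g (Ioi 0)) (hzc : ContinuousOn z (Ici 0))
    (hz0 : z 0 = 0) (hz : ∀ s, 0 < s → z s = θ s + g s)
    (hz' : ∀ s, 0 < s → HasDerivAt z (g s - A (θ s)) s)
    (hθi : IntervalIntegrable (fun s => ‖θ s‖ ^ 2) volume 0 t)
    (hgi : IntervalIntegrable (fun s => ‖g s‖ ^ 2) volume 0 t) :
    ∫ s in (0 : ℝ)..t, ‖θ s‖ ^ 2 ≤ (2 + 2 * t ^ 2) * ∫ s in (0 : ℝ)..t, ‖g s‖ ^ 2 := by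
  have hθ1 := intervalIntegrable_of_sq hθc ht hθi
  have hg1 := intervalIntegrable_of_sq hgc ht hgi
  have hsub {f : ℝ → F} (hf : IntervalIntegrable f volume 0 t) {s : ℝ} (hs : s ∈ Ioc 0 t) :
      IntervalIntegrable f volume 0 s :=
    hf.mono_set (by rw [uIcc_of_le hs.1.le, uIcc_of_le ht.le]; exact Icc_subset_Icc_right hs.2)
  have hsub' {f : ℝ → ℝ} (hf : IntervalIntegrable f volume 0 t) {s : ℝ} (hs : s ∈ Ioc 0 t) :
      IntervalIntegrable f volume 0 s :=
    hf.mono_set (by rw [uIcc_of_le hs.1.le, uIcc_of_le ht.le]; exact Icc_subset_Icc_right hs.2)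
  let Θ (s : ℝ) : F := ∫ r in (0 : ℝ)..s, θ r
  let G (s : ℝ) : F := ∫ r in (0 : ℝ)..s, g r
  have hprim {f : ℝ → F} (hf : IntervalIntegrable f volume 0 t) :
      ContinuousOn (fun s => ∫ r in (0 : ℝ)..s, f r) (Icc 0 t) := by
    have := continuousOn_primitive_interval (f := f) (a := 0) (b := t) (μ := volume)
      ((intervalIntegrable_iff' (by simp)).1 hf)
    rwa [uIcc_of_le ht.le] at this
  have hAi {s : ℝ} (hs : s ∈ Ioc 0 t) : IntervalIntegrable (fun r => A (θ r)) volume 0 s := by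
    have := (hsub hθ1 hs)
    rw [intervalIntegrable_iff] at this ⊢
    exact A.integrable_comp this
  -- The equation integrated once in time; the vanishing initial value leaves no boundary term.
  have hzs {s : ℝ} (hs : s ∈ Ioc 0 t) : z s = G s - A (Θ s) := by
    have h := integral_eq_sub_of_hasDerivAt_of_le hs.1.le (hzc.mono Icc_subset_Ici_self)
      (fun r hr => hz' r hr.1) ((hsub hg1 hs).sub (hAi hs))
    rw [integral_sub (hsub hg1 hs) (hAi hs), hz0, sub_zero,
      A.intervalIntegral_comp_comm (hsub hθ1 hs)] at h
    exact h.symm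
  have hΘ' {s : ℝ} (hs : s ∈ Ioo 0 t) : HasDerivAt Θ (θ s) s :=
    integral_hasDerivAt_right (hsub hθ1 ⟨hs.1, hs.2.le⟩)
      (hθc.stronglyMeasurableAtFilter isOpen_Ioi s hs.1) (hθc.continuousAt (Ioi_mem_nhds hs.1))
  let Q (s : ℝ) : ℝ := RCLike.re (inner 𝕜 (A (Θ s)) (Θ s))
  have hQ' {s : ℝ} (hs : s ∈ Ioo 0 t) :
      HasDerivAt Q (2 * RCLike.re (inner 𝕜 (A (Θ s)) (θ s))) s := by
    have hAΘ : HasDerivAt (fun r => A (Θ r)) (A (θ s)) s :=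
      (A.restrictScalars ℝ).hasFDerivAt.comp_hasDerivAt s (hΘ' hs)
    have h := (RCLike.reCLM (K := 𝕜)).hasFDerivAt.comp_hasDerivAt s (hAΘ.inner 𝕜 (hΘ' hs))
    refine h.congr_deriv ?_
    have hsym : inner 𝕜 (A (θ s)) (Θ s) = inner 𝕜 (θ s) (A (Θ s)) := hA.isSymmetric _ _
    simp only [RCLike.reCLM_apply, map_add, hsym]
    rw [inner_re_symm (θ s)]
    ring
  have hQc : ContinuousOn Q (Icc 0 t) :=
    RCLike.continuous_re.comp_continuousOn
      ((A.continuous.comp_continuousOn (hprim hθ1)).inner (𝕜 := 𝕜) (hprim hθ1))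
  have hGg : ContinuousOn (fun s => G s - g s) (Ioc 0 t) :=
    ((hprim hg1).mono Ioc_subset_Icc_self).sub (hgc.mono fun s hs => hs.1)
  have hGb {s : ℝ} (hs : s ∈ Ioc 0 t) :
      ‖G s - g s‖ ^ 2 ≤ 2 * (t * ∫ r in (0 : ℝ)..t, ‖g r‖ ^ 2) + 2 * ‖g s‖ ^ 2 := by
    have h1 := norm_sq_integral_le hs.1 (hsub hg1 hs) (hsub' hgi hs)
    have h2 : ∫ r in (0 : ℝ)..s, ‖g r‖ ^ 2 ≤ ∫ r in (0 : ℝ)..t, ‖g r‖ ^ 2 :=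
      integral_mono_interval le_rfl hs.1.le hs.2 (.of_forall fun r => by positivity) hgi
    have h3 : 0 ≤ ∫ r in (0 : ℝ)..s, ‖g r‖ ^ 2 :=
      integral_nonneg hs.1.le fun r _ => by positivity
    have h4 : ‖G s‖ ^ 2 ≤ t * ∫ r in (0 : ℝ)..t, ‖g r‖ ^ 2 :=
      h1.trans (mul_le_mul hs.2 h2 h3 ht.le)
    have h5 := norm_sub_le (G s) (g s)
    nlinarith [norm_nonneg (G s - g s), sq_nonneg (‖G s‖ - ‖g s‖)]
  have hbi : IntervalIntegrable
      (fun s => 2 * (t * ∫ r in (0 : ℝ)..t, ‖g r‖ ^ 2) + 2 * ‖g s‖ ^ 2) volume 0 t :=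
    intervalIntegrable_const.add (hgi.const_mul 2)
  have hφi : IntervalIntegrable (fun s => 2 * (t * ∫ r in (0 : ℝ)..t, ‖g r‖ ^ 2) + 2 * ‖g s‖ ^ 2
      - ‖θ s‖ ^ 2) volume 0 t := hbi.sub hθi
  -- Testing `θ + A Θ = G − g` with `θ` gives `Q' ≤ ‖G − g‖² − ‖θ‖²` for `Q = ⟨A Θ, Θ⟩`. Since `Q(0)
  -- = 0` and `Q(t) ≥ 0`, integration yields the bound; the `2 t²` comes from `G` and the `2` from
  -- `g`.
  have hmain := sub_le_integral_of_hasDeriv_right_of_le ht.le hQc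
    (fun s hs => (hQ' hs).hasDerivWithinAt)
    ((intervalIntegrable_iff_integrableOn_Icc_of_le ht.le).1 hφi) (fun s hs => ?_)
  · have hQ0 : Q 0 = 0 := by simp [Q, Θ]
    have hQt : 0 ≤ Q t := hA.re_inner_nonneg_left _
    rw [integral_sub hbi hθi, integral_add intervalIntegrable_const (hgi.const_mul 2),
      intervalIntegral.integral_const, intervalIntegral.integral_const_mul, hQ0] at hmain
    simp only [smul_eq_mul, sub_zero] at hmain
    linarith
  · have hs' : s ∈ Ioc 0 t := ⟨hs.1, hs.2.le⟩
    have h1 := hGb hs'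
    have h2 : θ s = (G s - g s) - A (Θ s) := by
      rw [eq_sub_of_add_eq (hz s hs.1).symm, hzs hs']; abel
    have h3 : ‖θ s‖ ^ 2 = RCLike.re (inner 𝕜 (G s - g s) (θ s))
        - RCLike.re (inner 𝕜 (A (Θ s)) (θ s)) := by
      rw [← map_sub, ← inner_sub_left, ← h2, inner_self_eq_norm_sq]
    have h4 := re_inner_le_norm (𝕜 := 𝕜) (G s - g s) (θ s)
    nlinarith [sq_nonneg (‖G s - g s‖ - ‖θ s‖)]

/-- The weighted energy estimate for `z = θ + g`, `z' + A θ = g`, `z(0) = 0`. -/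
theorem mul_norm_sq_le_of_energy (hA : A.IsPositive) (ht : 0 < t) (htT : t ≤ T)
    (hθd : ∀ s, 0 < s → DifferentiableAt ℝ θ s) (hgd : ∀ s, 0 < s → DifferentiableAt ℝ g s)
    (hzc : ContinuousOn z (Ici 0))
    (hz0 : z 0 = 0) (hz : ∀ s, 0 < s → z s = θ s + g s)
    (hz' : ∀ s, 0 < s → HasDerivAt z (g s - A (θ s)) s)
    (hθi : IntervalIntegrable (fun s => ‖θ s‖ ^ 2) volume 0 t)
    (hgi : IntervalIntegrable (fun s => ‖g s‖ ^ 2) volume 0 t)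
    (hg'i : IntervalIntegrable (fun s => s ^ 2 * ‖deriv g s‖ ^ 2) volume 0 t)
    (hθb : ∃ M, ∀ s ∈ Ioc 0 t, s * ‖θ s‖ ^ 2 ≤ M) :
    t * ‖θ t‖ ^ 2 ≤ (∫ s in (0 : ℝ)..t, s ^ 2 * ‖deriv g s‖ ^ 2)
      + ((3 + T) * (2 + 2 * T ^ 2) + T) * ∫ s in (0 : ℝ)..t, ‖g s‖ ^ 2 := by
  have hθc : ContinuousOn θ (Ioi 0) := fun s hs => (hθd s hs).continuousAt.continuousWithinAt
  have hgc : ContinuousOn g (Ioi 0) := fun s hs => (hgd s hs).continuousAt.continuousWithinAt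
  have hL2 := integral_norm_sq_le_of_energy hA ht hθc hgc hzc hz0 hz hz' hθi hgi
  obtain ⟨M, hM⟩ := hθb
  let q (s : ℝ) : ℝ := s ^ 2 * ‖θ s‖ ^ 2
  have hθ' {s : ℝ} (hs : 0 < s) : deriv θ s = g s - A (θ s) - deriv g s := by
    have h1 : HasDerivAt (fun r => z r - g r) (g s - A (θ s) - deriv g s) s :=
      (hz' s hs).sub (hgd s hs).hasDerivAt
    have h2 : θ =ᶠ[nhds s] fun r => z r - g r :=
      Filter.mem_of_superset (Ioi_mem_nhds hs) fun r hr => by simp [hz r hr]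
    rw [h2.deriv_eq, h1.deriv]
  have hq' {s : ℝ} (hs : 0 < s) : HasDerivAt q
      (2 * s * ‖θ s‖ ^ 2 + s ^ 2 * (2 * RCLike.re (inner 𝕜 (θ s) (deriv θ s)))) s := by
    have := (hasDerivAt_pow 2 s).mul (hasDerivAt_norm_sq 𝕜 (hθd s hs).hasDerivAt)
    refine this.congr_deriv ?_
    simp
  have hqc : ContinuousOn q (Icc 0 t) := by
    intro s hs
    rcases hs.1.eq_or_lt with rfl | hs0
    -- Continuity at `0`, where `θ` itself may blow up: `q(s) = s · (s ‖θ‖²) ≤ s M`.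
    · have hq0 : q 0 = 0 := by simp [q]
      rw [ContinuousWithinAt, hq0]
      have hlim : Filter.Tendsto (fun s : ℝ => s * M) (nhdsWithin 0 (Icc 0 t)) (nhds 0) := by
        have : Continuous fun s : ℝ => s * M := by fun_prop
        simpa using (this.tendsto 0).mono_left nhdsWithin_le_nhds
      refine tendsto_of_tendsto_of_tendsto_of_le_of_le' tendsto_const_nhds hlim
        (.of_forall fun s => by positivity) (eventually_mem_nhdsWithin.mono fun s hs => ?_)
      rcases hs.1.eq_or_lt with rfl | hs0
      · simp [q]
      · have := mul_le_mul_of_nonneg_left (hM s ⟨hs0, hs.2⟩) hs0.le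
        calc q s = s * (s * ‖θ s‖ ^ 2) := by simp only [q]; ring
          _ ≤ s * M := this
    · exact (hq' hs0).continuousAt.continuousWithinAt
  have hT : 0 < T := ht.trans_le htT
  -- One factor `s ≤ t` is pulled out of `q'` so that it cancels against `q(t) = t · (t ‖θ(t)‖²)`.
  -- In `3 + T`, the weight contributes `2`, Young's inequality for `g'` contributes `1`, and for
  -- `g` it contributes `T`.
  have hφi : IntervalIntegrable (fun s => t * ((3 + T) * ‖θ s‖ ^ 2 + s ^ 2 * ‖deriv g s‖ ^ 2
      + T * ‖g s‖ ^ 2)) volume 0 t :=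
    (((hθi.const_mul _).add hg'i).add (hgi.const_mul _)).const_mul _
  have hmain := sub_le_integral_of_hasDeriv_right_of_le ht.le hqc
    (fun s hs => (hq' hs.1).hasDerivWithinAt)
    ((intervalIntegrable_iff_integrableOn_Icc_of_le ht.le).1 hφi) (fun s hs => ?_)
  · rw [intervalIntegral.integral_const_mul,
      integral_add ((hθi.const_mul _).add hg'i) (hgi.const_mul _),
      integral_add (hθi.const_mul _) hg'i, intervalIntegral.integral_const_mul,
      intervalIntegral.integral_const_mul] at hmain
    have h1 : t * (t * ‖θ t‖ ^ 2) = q t - q 0 := by simp only [q]; ring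
    rw [← h1] at hmain
    have h2 := le_of_mul_le_mul_left hmain ht
    have h3 : 0 ≤ ∫ s in (0 : ℝ)..t, ‖g s‖ ^ 2 := integral_nonneg ht.le fun r _ => by positivity
    have h4 : (2 + 2 * t ^ 2) * ∫ s in (0 : ℝ)..t, ‖g s‖ ^ 2 ≤
        (2 + 2 * T ^ 2) * ∫ s in (0 : ℝ)..t, ‖g s‖ ^ 2 := by gcongr
    nlinarith [mul_le_mul_of_nonneg_left (hL2.trans h4) (by linarith : (0 : ℝ) ≤ 3 + T)]
  · have hs0 : 0 < s := hs.1
    have hpos : 0 ≤ RCLike.re (inner 𝕜 (θ s) (A (θ s))) := by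
      rw [inner_re_symm]; exact hA.re_inner_nonneg_left _
    have h1 := re_inner_le_norm (𝕜 := 𝕜) (θ s) (g s)
    have h2 := re_inner_le_norm (𝕜 := 𝕜) (θ s) (-deriv g s)
    rw [norm_neg, inner_neg_right, map_neg] at h2
    rw [hθ' hs0, inner_sub_right, inner_sub_right, map_sub, map_sub]
    have h3 : 2 * (s * ‖deriv g s‖ * ‖θ s‖) ≤ s ^ 2 * ‖deriv g s‖ ^ 2 + ‖θ s‖ ^ 2 := by
      nlinarith [sq_nonneg (s * ‖deriv g s‖ - ‖θ s‖)]
    have h4 : 2 * (‖θ s‖ * ‖g s‖) ≤ ‖θ s‖ ^ 2 + ‖g s‖ ^ 2 := by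
      nlinarith [sq_nonneg (‖θ s‖ - ‖g s‖)]
    calc 2 * s * ‖θ s‖ ^ 2 + s ^ 2 * (2 * (RCLike.re (inner 𝕜 (θ s) (g s))
          - RCLike.re (inner 𝕜 (θ s) (A (θ s))) - RCLike.re (inner 𝕜 (θ s) (deriv g s))))
        ≤ 2 * s * ‖θ s‖ ^ 2 + s ^ 2 * (2 * (‖θ s‖ * ‖g s‖ + ‖θ s‖ * ‖deriv g s‖)) := by
          gcongr; linarith
      _ = s * (2 * ‖θ s‖ ^ 2 + s * (2 * (‖θ s‖ * ‖g s‖)) + 2 * (s * ‖deriv g s‖ * ‖θ s‖)) := by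
          ring
      _ ≤ s * (2 * ‖θ s‖ ^ 2 + T * (‖θ s‖ ^ 2 + ‖g s‖ ^ 2)
          + (s ^ 2 * ‖deriv g s‖ ^ 2 + ‖θ s‖ ^ 2)) := by
          gcongr
          exact hs.2.le.trans htT
      _ = s * ((3 + T) * ‖θ s‖ ^ 2 + s ^ 2 * ‖deriv g s‖ ^ 2 + T * ‖g s‖ ^ 2) := by ring
      _ ≤ t * ((3 + T) * ‖θ s‖ ^ 2 + s ^ 2 * ‖deriv g s‖ ^ 2 + T * ‖g s‖ ^ 2) := by
          gcongr
          exact hs.2.le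

end Energy

section Diagonal

/-! ### Abstract heat equation for a diagonal operator -/

variable {𝕜 : Type*} [RCLike 𝕜] {H : Type*} [NormedAddCommGroup H] [InnerProductSpace 𝕜 H]
  {ι : Type*}

/-- The domain of the quadratic form with eigenvectors `e i` and eigenvalues `lam i`. -/
def formDomain (e : ι → H) (lam : ι → ℝ) : Submodule 𝕜 H where
  carrier := {v | Memℓp (fun i => ((Real.sqrt (lam i) : ℝ) : 𝕜) * inner 𝕜 (e i) v) 2}
  zero_mem' := by
    simp only [Set.mem_ofPred_eq, inner_zero_right, mul_zero]
    exact zero_memℓp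
  add_mem' {v w} hv hw := by
    simp only [Set.mem_ofPred_eq, inner_add_right, mul_add] at *
    exact hv.add hw
  smul_mem' c v hv := by
    simp only [Set.mem_ofPred_eq, inner_smul_right] at *
    convert hv.const_smul c using 1
    ext i
    simp
    ring

/-- The square root of the diagonal operator, with values in `ℓ²`. -/
def formRoot (e : ι → H) (lam : ι → ℝ) :
    formDomain (𝕜 := 𝕜) e lam →ₗ[𝕜] lp (fun _ : ι => 𝕜) 2 where
  toFun v := ⟨fun i => ((Real.sqrt (lam i) : ℝ) : 𝕜) * inner 𝕜 (e i) (v : H), v.2⟩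
  map_add' v w := by
    ext i
    simp [inner_add_right, mul_add]
    rfl
  map_smul' c v := by
    ext i
    simp [inner_smul_right]
    ring

variable {e : ι → H} {lam : ι → ℝ}

theorem mem_formDomain_iff (hlam : ∀ i, 0 ≤ lam i) {v : H} :
    v ∈ formDomain (𝕜 := 𝕜) e lam ↔ Summable fun i => lam i * ‖inner 𝕜 (e i) v‖ ^ 2 := by
  change Memℓp _ _ ↔ _
  rw [memℓp_gen_iff (by norm_num)]
  refine summable_congr fun i => ?_
  simp [mul_pow, Real.sq_sqrt (hlam i)]

theorem inner_formRoot (hlam : ∀ i, 0 ≤ lam i) (v w : formDomain (𝕜 := 𝕜) e lam) :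
    inner 𝕜 (formRoot e lam v) (formRoot e lam w) =
      ∑' i, ((lam i : ℝ) : 𝕜) * (inner 𝕜 (e i) (w : H) * inner 𝕜 (v : H) (e i)) := by
  rw [lp.inner_eq_tsum]
  refine tsum_congr fun i => ?_
  have h : ((Real.sqrt (lam i) : ℝ) : 𝕜) * ((Real.sqrt (lam i) : ℝ) : 𝕜) = ((lam i : ℝ) : 𝕜) := by
    rw [← RCLike.ofReal_mul, Real.mul_self_sqrt (hlam i)]
  simp only [formRoot, LinearMap.coe_mk, AddHom.coe_mk, RCLike.inner_apply, map_mul,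
    RCLike.conj_ofReal, inner_conj_symm]
  rw [← h]
  ring

theorem norm_formRoot_sq (hlam : ∀ i, 0 ≤ lam i) (v : formDomain (𝕜 := 𝕜) e lam) :
    ‖formRoot e lam v‖ ^ 2 = ∑' i, lam i * ‖inner 𝕜 (e i) (v : H)‖ ^ 2 := by
  have h := lp.norm_rpow_eq_tsum (p := 2) (by norm_num) (formRoot e lam v)
  norm_num at h
  rw [h]
  refine tsum_congr fun i => ?_
  simp [formRoot, mul_pow, Real.sq_sqrt (hlam i)]

theorem mem_formDomain_basis (he : Orthonormal 𝕜 e) (hlam : ∀ i, 0 ≤ lam i) (i : ι) :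
    e i ∈ formDomain (𝕜 := 𝕜) e lam := by
  classical
  rw [mem_formDomain_iff hlam]
  refine summable_of_ne_finset_zero (s := {i}) fun j hj => ?_
  rw [orthonormal_iff_ite.1 he, if_neg (by simpa using hj)]
  simp

theorem inner_formRoot_basis (he : Orthonormal 𝕜 e) (hlam : ∀ i, 0 ≤ lam i) (i : ι)
    (w : formDomain (𝕜 := 𝕜) e lam) :
    inner 𝕜 (formRoot e lam ⟨e i, mem_formDomain_basis he hlam i⟩) (formRoot e lam w) =
      ((lam i : ℝ) : 𝕜) * inner 𝕜 (e i) (w : H) := by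
  classical
  rw [inner_formRoot hlam, tsum_eq_single i]
  · simp [he.1 i]
  · intro j hj
    simp [orthonormal_iff_ite.1 he, hj.symm]

/-- With the next bound, the scalar source of parabolic smoothing; `x` will be `λ_i` times an
elapsed time. -/
theorem mul_exp_neg_le_one {x : ℝ} : x * Real.exp (-x) ≤ 1 := by
  have h := Real.add_one_le_exp x
  have h2 : Real.exp x * Real.exp (-x) = 1 := by rw [← Real.exp_add]; simp
  nlinarith [Real.exp_pos (-x)]

theorem sq_mul_exp_neg_le_one {x : ℝ} (hx : 0 ≤ x) : x ^ 2 * Real.exp (-x) ≤ 1 := by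
  have h1 : Real.exp (x / 2) * Real.exp (x / 2) = Real.exp x := by rw [← Real.exp_add]; simp
  have h2 : Real.exp x * Real.exp (-x) = 1 := by rw [← Real.exp_add]; simp
  have h3 : x ^ 2 ≤ Real.exp x := by
    have h4 := Real.quadratic_le_exp_of_nonneg (x := x / 2) (by linarith)
    have h5 : x ≤ Real.exp (x / 2) := by nlinarith [sq_nonneg (x - 2)]
    nlinarith
  nlinarith [Real.exp_pos (-x)]

variable [NormedSpace ℝ H]

/-- Solutions on `(0, ∞)` of the weak heat equation for the form `⟨T v, T w⟩`. -/
structure IsWeakHeat {G : Type*} [NormedAddCommGroup G] [InnerProductSpace 𝕜 G]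
    {D : Submodule 𝕜 H} (T : D →ₗ[𝕜] G) (u : ℝ → H) : Prop where
  differentiableAt : ∀ t, 0 < t → DifferentiableAt ℝ u t
  mem : ∀ t, 0 < t → u t ∈ D
  weak : ∀ t (ht : 0 < t) (v : D),
    inner 𝕜 (v : H) (deriv u t) + inner 𝕜 (T v) (T ⟨u t, mem t ht⟩) = 0

variable {u : ℝ → H}

theorem inner_basis_deriv (he : Orthonormal 𝕜 e) (hlam : ∀ i, 0 ≤ lam i)
    (hu : IsWeakHeat (formRoot (𝕜 := 𝕜) e lam) u) {t : ℝ} (ht : 0 < t) (i : ι) :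
    inner 𝕜 (e i) (deriv u t) = -((lam i : ℝ) : 𝕜) * inner 𝕜 (e i) (u t) := by
  have h := hu.weak t ht ⟨e i, mem_formDomain_basis he hlam i⟩
  rw [inner_formRoot_basis he hlam] at h
  linear_combination h

theorem hasDerivAt_inner_basis (hu : ∀ t, 0 < t → DifferentiableAt ℝ u t) {t : ℝ} (ht : 0 < t)
    (v : H) : HasDerivAt (fun s => inner 𝕜 v (u s)) (inner 𝕜 v (deriv u t)) t := by
  have h := (hasDerivAt_const t v).inner 𝕜 (hu t ht).hasDerivAt
  simpa using h

/-- Testing with `e i` gives the scalar equation `c' = −λ_i c`, so `exp(λ_i r) c(r)` is constant on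
`(0, ∞)`. Both times are positive because the equation is not imposed at `0`. -/
theorem inner_basis_eq_exp (he : Orthonormal 𝕜 e) (hlam : ∀ i, 0 ≤ lam i)
    (hu : IsWeakHeat (formRoot (𝕜 := 𝕜) e lam) u) {s t : ℝ} (hs : 0 < s) (ht : 0 < t) (i : ι) :
    inner 𝕜 (e i) (u t) = ((Real.exp (-(lam i * (t - s))) : ℝ) : 𝕜) * inner 𝕜 (e i) (u s) := by
  let f (r : ℝ) : 𝕜 := Real.exp (lam i * r) • inner 𝕜 (e i) (u r)
  have hf (r : ℝ) (hr : 0 < r) : HasDerivAt f 0 r := by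
    have h1 : HasDerivAt (fun r => Real.exp (lam i * r)) (Real.exp (lam i * r) * lam i) r := by
      simpa using ((hasDerivAt_id r).const_mul (lam i)).exp
    refine (h1.smul (hasDerivAt_inner_basis (𝕜 := 𝕜) hu.differentiableAt hr (e i))).congr_deriv ?_
    rw [inner_basis_deriv he hlam hu hr]
    simp only [RCLike.real_smul_eq_coe_mul, RCLike.ofReal_mul]
    ring
  have h := isOpen_Ioi.is_const_of_deriv_eq_zero isPreconnected_Ioi
    (fun r hr => (hf r hr).differentiableAt.differentiableWithinAt)
    (fun r hr => (hf r hr).deriv) (Set.mem_Ioi.2 hs) (Set.mem_Ioi.2 ht)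
  simp only [f, RCLike.real_smul_eq_coe_mul] at h
  have h2 : Real.exp (-(lam i * (t - s))) = Real.exp (-(lam i * t)) * Real.exp (lam i * s) := by
    rw [← Real.exp_add]; ring_nf
  have h3 : ((Real.exp (-(lam i * t)) : ℝ) : 𝕜) * ((Real.exp (lam i * t) : ℝ) : 𝕜) = 1 := by
    rw [← RCLike.ofReal_mul, ← Real.exp_add]; simp
  rw [h2, RCLike.ofReal_mul, mul_assoc, h, ← mul_assoc, h3, one_mul]

theorem norm_inner_basis_eq_exp (he : Orthonormal 𝕜 e) (hlam : ∀ i, 0 ≤ lam i)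
    (hu : IsWeakHeat (formRoot (𝕜 := 𝕜) e lam) u) {s t : ℝ} (hs : 0 < s) (ht : 0 < t) (i : ι) :
    ‖inner 𝕜 (e i) (u t)‖ = Real.exp (-(lam i * (t - s))) * ‖inner 𝕜 (e i) (u s)‖ := by
  rw [inner_basis_eq_exp he hlam hu hs ht, norm_mul, RCLike.norm_ofReal, abs_of_pos (Real.exp_pos _)]

theorem norm_inner_basis_sq_eq_exp (he : Orthonormal 𝕜 e) (hlam : ∀ i, 0 ≤ lam i)
    (hu : IsWeakHeat (formRoot (𝕜 := 𝕜) e lam) u) {t : ℝ} (ht : 0 < t) (i : ι) :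
    ‖inner 𝕜 (e i) (u t)‖ ^ 2 = Real.exp (-(lam i * t)) * ‖inner 𝕜 (e i) (u (t / 2))‖ ^ 2 := by
  rw [norm_inner_basis_eq_exp he hlam hu (half_pos ht) ht, mul_pow, ← Real.exp_nat_mul]
  congr 2
  push_cast
  ring

/-- Smoothing from `L₂` to the form domain: half of the elapsed time pays for one factor `λ_i`, and
Bessel's inequality bounds the remaining sum. -/
theorem mul_norm_formRoot_sq_le (he : Orthonormal 𝕜 e) (hlam : ∀ i, 0 ≤ lam i)
    (hu : IsWeakHeat (formRoot (𝕜 := 𝕜) e lam) u) {t : ℝ} (ht : 0 < t) :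
    t * ‖formRoot e lam ⟨u t, hu.mem t ht⟩‖ ^ 2 ≤ ‖u (t / 2)‖ ^ 2 := by
  rw [norm_formRoot_sq hlam, ← tsum_mul_left]
  refine le_trans ?_ (he.tsum_inner_products_le (u (t / 2)))
  refine Summable.tsum_le_tsum (fun i => ?_)
    (((mem_formDomain_iff hlam).1 (hu.mem t ht)).mul_left t) (he.inner_products_summable _)
  simp only
  rw [norm_inner_basis_sq_eq_exp he hlam hu ht]
  calc t * (lam i * (Real.exp (-(lam i * t)) * ‖inner 𝕜 (e i) (u (t / 2))‖ ^ 2))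
      = (lam i * t * Real.exp (-(lam i * t))) * ‖inner 𝕜 (e i) (u (t / 2))‖ ^ 2 := by ring
    _ ≤ 1 * ‖inner 𝕜 (e i) (u (t / 2))‖ ^ 2 := by gcongr; exact mul_exp_neg_le_one
    _ = _ := one_mul _

theorem sq_mul_coeff_deriv_le (he : Orthonormal 𝕜 e) (hlam : ∀ i, 0 ≤ lam i)
    (hu : IsWeakHeat (formRoot (𝕜 := 𝕜) e lam) u) {t : ℝ} (ht : 0 < t) (i : ι) :
    t ^ 2 * (lam i * ‖inner 𝕜 (e i) (deriv u t)‖ ^ 2) ≤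
      lam i * ‖inner 𝕜 (e i) (u (t / 2))‖ ^ 2 := by
  have h0 := hlam i
  rw [inner_basis_deriv he hlam hu ht, norm_mul, mul_pow, norm_inner_basis_sq_eq_exp he hlam hu ht,
    norm_neg, RCLike.norm_ofReal, sq_abs]
  calc t ^ 2 * (lam i * (lam i ^ 2 * (Real.exp (-(lam i * t))
        * ‖inner 𝕜 (e i) (u (t / 2))‖ ^ 2)))
      = ((lam i * t) ^ 2 * Real.exp (-(lam i * t)))
        * (lam i * ‖inner 𝕜 (e i) (u (t / 2))‖ ^ 2) := by ring
    _ ≤ 1 * (lam i * ‖inner 𝕜 (e i) (u (t / 2))‖ ^ 2) := by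
        gcongr
        exact sq_mul_exp_neg_le_one (by positivity)
    _ = _ := one_mul _

/-- Exponential decay from time `t/2` absorbs the factor `λ_i²` produced by the derivative, and
`u(t/2)` is already in the form domain. This makes `u'` an admissible test function. -/
theorem deriv_mem_formDomain (he : Orthonormal 𝕜 e) (hlam : ∀ i, 0 ≤ lam i)
    (hu : IsWeakHeat (formRoot (𝕜 := 𝕜) e lam) u) {t : ℝ} (ht : 0 < t) :
    deriv u t ∈ formDomain (𝕜 := 𝕜) e lam := by
  rw [mem_formDomain_iff hlam]
  have h := (mem_formDomain_iff hlam).1 (hu.mem (t / 2) (half_pos ht))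
  have h2 := Summable.of_nonneg_of_le
    (fun i => mul_nonneg (sq_nonneg t) (mul_nonneg (hlam i) (sq_nonneg _)))
    (fun i => sq_mul_coeff_deriv_le he hlam hu ht i) h
  exact (summable_mul_left_iff (by positivity)).1 h2

theorem sq_mul_norm_formRoot_deriv_sq_le (he : Orthonormal 𝕜 e) (hlam : ∀ i, 0 ≤ lam i)
    (hu : IsWeakHeat (formRoot (𝕜 := 𝕜) e lam) u) {t : ℝ} (ht : 0 < t) :
    t ^ 2 * ‖formRoot e lam ⟨deriv u t, deriv_mem_formDomain he hlam hu ht⟩‖ ^ 2 ≤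
      ‖formRoot e lam ⟨u (t / 2), hu.mem (t / 2) (half_pos ht)⟩‖ ^ 2 := by
  rw [norm_formRoot_sq hlam, norm_formRoot_sq hlam, ← tsum_mul_left]
  exact Summable.tsum_le_tsum (fun i => sq_mul_coeff_deriv_le he hlam hu ht i)
    (((mem_formDomain_iff hlam).1 (deriv_mem_formDomain he hlam hu ht)).mul_left _)
    ((mem_formDomain_iff hlam).1 (hu.mem (t / 2) (half_pos ht)))

/-- A weak second time derivative: `⟨χ, u'⟩` is replaced by the eigenfunction series of the form,
which is differentiated termwise. -/
theorem hasDerivAt_inner_deriv (he : Orthonormal 𝕜 e) (hlam : ∀ i, 0 ≤ lam i)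
    (hu : IsWeakHeat (formRoot (𝕜 := 𝕜) e lam) u) {t : ℝ} (ht : 0 < t)
    (χ : formDomain (𝕜 := 𝕜) e lam) :
    HasDerivAt (fun s => inner 𝕜 (χ : H) (deriv u s))
      (-inner 𝕜 (formRoot e lam χ)
        (formRoot e lam ⟨deriv u t, deriv_mem_formDomain he hlam hu ht⟩)) t := by
  let c (i : ι) : 𝕜 := ((lam i : ℝ) : 𝕜) * inner 𝕜 (χ : H) (e i)
  let r := t / 2
  have hr : 0 < r := half_pos ht
  have hbasic : HasDerivAt (fun s => ∑' i, c i * inner 𝕜 (e i) (u s))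
      (∑' i, c i * inner 𝕜 (e i) (deriv u t)) t := by
    -- Majorant uniform in `s > r`: the elapsed time since `r/2` is at least `r/2`, and `λ² exp(−λ
    -- r/2) ≤ (2/r)²`.
    have hsum : Summable fun i => (2 / r) ^ 2 * (‖inner 𝕜 (e i) (χ : H)‖ ^ 2
        + ‖inner 𝕜 (e i) (u (r / 2))‖ ^ 2) :=
      ((he.inner_products_summable _).add (he.inner_products_summable _)).mul_left _
    refine hasDerivAt_tsum_of_isPreconnected hsum (isOpen_Ioi (a := r)) isPreconnected_Ioi
      (fun i s hs => (hasDerivAt_inner_basis (𝕜 := 𝕜) hu.differentiableAt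
        (hr.trans hs) (e i)).const_mul _) (fun i s hs => ?_)
      (Set.mem_Ioi.2 (half_lt_self ht)) ?_ (Set.mem_Ioi.2 (half_lt_self ht))
    · have hs0 : 0 < s := hr.trans hs
      have h0 := hlam i
      have hrs : r ≤ s := le_of_lt hs
      rw [inner_basis_deriv he hlam hu hs0, norm_mul, norm_mul, norm_mul, norm_neg,
        RCLike.norm_ofReal, abs_of_nonneg h0, norm_inner_basis_eq_exp he hlam hu (half_pos hr) hs0,
        norm_inner_symm (χ : H)]
      set x := ‖inner 𝕜 (e i) (χ : H)‖
      set y := ‖inner 𝕜 (e i) (u (r / 2))‖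
      have hx : 0 ≤ x := norm_nonneg _
      have hy : 0 ≤ y := norm_nonneg _
      have hexp : Real.exp (-(lam i * (s - r / 2))) ≤ Real.exp (-(lam i * (r / 2))) := by
        refine Real.exp_le_exp.2 (neg_le_neg (mul_le_mul_of_nonneg_left ?_ h0))
        linarith
      have hle : lam i ^ 2 * Real.exp (-(lam i * (s - r / 2))) ≤ (2 / r) ^ 2 := by
        have h1 := sq_mul_exp_neg_le_one (x := lam i * (r / 2)) (by positivity)
        calc lam i ^ 2 * Real.exp (-(lam i * (s - r / 2)))
            ≤ lam i ^ 2 * Real.exp (-(lam i * (r / 2))) := by gcongr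
          _ = (2 / r) ^ 2 * ((lam i * (r / 2)) ^ 2 * Real.exp (-(lam i * (r / 2)))) := by
              field_simp
          _ ≤ (2 / r) ^ 2 * 1 := by gcongr
          _ = _ := mul_one _
      calc lam i * x * (lam i * (Real.exp (-(lam i * (s - r / 2))) * y))
          = (lam i ^ 2 * Real.exp (-(lam i * (s - r / 2)))) * (x * y) := by ring
        _ ≤ (2 / r) ^ 2 * (x ^ 2 + y ^ 2) := by
            gcongr
            nlinarith [sq_nonneg (x - y), mul_nonneg hx hy]
    · have h := lp.summable_inner (𝕜 := 𝕜) (formRoot e lam χ) (formRoot e lam ⟨u t, hu.mem t ht⟩)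
      refine h.congr fun i => ?_
      have h : ((Real.sqrt (lam i) : ℝ) : 𝕜) * ((Real.sqrt (lam i) : ℝ) : 𝕜)
          = ((lam i : ℝ) : 𝕜) := by
        rw [← RCLike.ofReal_mul, Real.mul_self_sqrt (hlam i)]
      simp only [c, formRoot, LinearMap.coe_mk, AddHom.coe_mk, RCLike.inner_apply, map_mul,
        RCLike.conj_ofReal, inner_conj_symm]
      rw [← h]
      ring
  have hev : (fun s => inner 𝕜 (χ : H) (deriv u s)) =ᶠ[nhds t]
      fun s => -∑' i, c i * inner 𝕜 (e i) (u s) := by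
    refine Filter.mem_of_superset (Ioi_mem_nhds ht) fun s hs => ?_
    have h := hu.weak s hs χ
    rw [inner_formRoot hlam] at h
    simp only [Set.mem_ofPred_eq, c]
    rw [eq_neg_of_add_eq_zero_left h]
    congr 1
    exact tsum_congr fun i => by ring
  refine (hbasic.neg.congr_of_eventuallyEq hev).congr_deriv ?_
  rw [inner_formRoot hlam]
  congr 1
  exact tsum_congr fun i => by simp only [c]; ring

end Diagonal

section Ritz

/-! ### The abstract Ritz projection -/

variable {𝕜 : Type*} [RCLike 𝕜] {H : Type*} [NormedAddCommGroup H] [InnerProductSpace 𝕜 H]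
  {G : Type*} [NormedAddCommGroup G] [InnerProductSpace 𝕜 G] {D : Submodule 𝕜 H}

/-- The operator of the form `⟨T v, T w⟩` on a finite-dimensional subspace, together with
the inverse of its sum with the identity. -/
theorem exists_ritz_operator [CompleteSpace G] (T : D →ₗ[𝕜] G) {S : Submodule 𝕜 H}
    [FiniteDimensional 𝕜 S] (hS : S ≤ D) :
    ∃ A L : S →L[𝕜] S, A.IsPositive ∧
      (∀ χ w : S, inner 𝕜 χ (A w) =
        inner 𝕜 (T (Submodule.inclusion hS χ)) (T (Submodule.inclusion hS w))) ∧
      (∀ w, L (w + A w) = w) ∧ ∀ y, L y + A (L y) = y := by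
  have : CompleteSpace S := FiniteDimensional.complete 𝕜 S
  let TS : S →L[𝕜] G := LinearMap.toContinuousLinearMap (T ∘ₗ Submodule.inclusion hS)
  let A : S →L[𝕜] S := ContinuousLinearMap.adjoint TS ∘L TS
  have hA : A.IsPositive := ContinuousLinearMap.isPositive_adjoint_comp_self TS
  have hAi (χ w : S) : inner 𝕜 χ (A w) =
        inner 𝕜 (T (Submodule.inclusion hS χ)) (T (Submodule.inclusion hS w)) :=
    ContinuousLinearMap.adjoint_inner_right TS χ (TS w)
  let B : S →ₗ[𝕜] S := LinearMap.id + A.toLinearMap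
  have hinj : Function.Injective B := by
    rw [← LinearMap.ker_eq_bot, LinearMap.ker_eq_bot']
    intro w hw
    have h1 : w + A w = 0 := hw
    have h2 := hA.re_inner_nonneg_left w
    rw [eq_neg_of_add_eq_zero_right h1, inner_neg_left, map_neg, inner_self_eq_norm_sq] at h2
    have h3 : ‖w‖ = 0 := by nlinarith [norm_nonneg w]
    exact norm_eq_zero.1 h3
  let E := LinearEquiv.ofInjectiveEndo B hinj
  refine ⟨A, LinearMap.toContinuousLinearMap (E.symm : S →ₗ[𝕜] S), hA, hAi, fun w => ?_, fun y => ?_⟩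
  · exact E.symm_apply_apply w
  · exact E.apply_symm_apply y

/-- The functional on the right is represented in `S` by the projection of `v` plus the adjoint of
`T` restricted to `S`, applied to `T v`; inverting `1 + A` gives the solution. -/
theorem exists_ritz [CompleteSpace G] (T : D →ₗ[𝕜] G) {S : Submodule 𝕜 H}
    [FiniteDimensional 𝕜 S] (hS : S ≤ D) (v : D) :
    ∃ w : S, ∀ χ : S, inner 𝕜 (T (Submodule.inclusion hS χ)) (T (Submodule.inclusion hS w))
      + inner 𝕜 (χ : H) (w : H) = inner 𝕜 (T (Submodule.inclusion hS χ)) (T v)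
      + inner 𝕜 (χ : H) (v : H) := by
  have : CompleteSpace S := FiniteDimensional.complete 𝕜 S
  obtain ⟨A, L, -, hA, -, hL⟩ := exists_ritz_operator T hS
  let TS : S →L[𝕜] G := LinearMap.toContinuousLinearMap (T ∘ₗ Submodule.inclusion hS)
  refine ⟨L (S.orthogonalProjectionOnto (v : H) + ContinuousLinearMap.adjoint TS (T v)), fun χ => ?_⟩
  rw [← hA, ← Submodule.coe_inner, ← inner_add_right, add_comm (A _), hL, inner_add_right,
    ContinuousLinearMap.adjoint_inner_right, Submodule.inner_orthogonalProjectionOnto_eq_of_mem_left,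
    add_comm]
  rfl

/-- Contractivity of the Ritz projection in the energy norm, seen by testing with `w` itself; the
term `‖T w‖²` is dropped. -/
theorem norm_sq_le_of_ritz (T : D →ₗ[𝕜] G) (w v : D)
    (h : inner 𝕜 (w : H) (w : H) + inner 𝕜 (T w) (T w) =
      inner 𝕜 (w : H) (v : H) + inner 𝕜 (T w) (T v)) :
    ‖(w : H)‖ ^ 2 ≤ ‖(v : H)‖ ^ 2 + ‖T v‖ ^ 2 := by
  have h1 := congrArg RCLike.re h
  rw [map_add, map_add, inner_self_eq_norm_sq, inner_self_eq_norm_sq] at h1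
  have h2 := re_inner_le_norm (𝕜 := 𝕜) (w : H) (v : H)
  have h3 := re_inner_le_norm (𝕜 := 𝕜) (T w) (T v)
  nlinarith [sq_nonneg (‖(w : H)‖ - ‖(v : H)‖), sq_nonneg (‖T w‖ - ‖T v‖), sq_nonneg ‖T w‖]

end Ritz

/-! ### Integrability of the energy and control of the time derivative. -/

section HeatBounds

open Set

variable {𝕜 : Type*} [RCLike 𝕜] {H : Type*} [NormedAddCommGroup H] [InnerProductSpace 𝕜 H]
  [NormedSpace ℝ H] {ι : Type*} {e : ι → H} {lam : ι → ℝ} {u : ℝ → H}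

theorem IsWeakHeat.re_inner_deriv {G : Type*} [NormedAddCommGroup G] [InnerProductSpace 𝕜 G]
    {D : Submodule 𝕜 H} {T : D →ₗ[𝕜] G} (hu : IsWeakHeat T u) {t : ℝ} (ht : 0 < t) :
    RCLike.re (inner 𝕜 (u t) (deriv u t)) = -‖T ⟨u t, hu.mem t ht⟩‖ ^ 2 := by
  have h := congrArg RCLike.re (hu.weak t ht ⟨u t, hu.mem t ht⟩)
  rw [map_add, map_zero, inner_self_eq_norm_sq] at h
  linarith

/-- The integrand is the nonnegative derivative of `−½ ‖u‖²`, which is continuous up to `0`; hence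
it is integrable however singular it is there. -/
theorem IsWeakHeat.intervalIntegrable_energy {G : Type*} [NormedAddCommGroup G]
    [InnerProductSpace 𝕜 G] {D : Submodule 𝕜 H} {T : D →ₗ[𝕜] G} (hu : IsWeakHeat T u)
    (huc : ContinuousOn u (Ici 0)) {t : ℝ} (ht : 0 < t) :
    IntervalIntegrable (fun s => -RCLike.re (inner 𝕜 (u s) (deriv u s))) volume 0 t := by
  refine intervalIntegral.intervalIntegrable_deriv_of_nonneg
    (g := fun s => -(1 / 2) * ‖u s‖ ^ 2) ?_ (fun s hs => ?_) (fun s hs => ?_)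
  · rw [uIcc_of_le ht.le]
    exact ((huc.mono Icc_subset_Ici_self).norm.pow 2).const_mul _
  · rw [min_eq_left ht.le] at hs
    refine ((hasDerivAt_norm_sq 𝕜 (hu.differentiableAt s hs.1).hasDerivAt).const_mul
      (-(1 / 2))).congr_deriv ?_
    ring
  · rw [min_eq_left ht.le] at hs
    rw [hu.re_inner_deriv hs.1, neg_neg]
    positivity

/-- Testing with `u'` gives `‖u'‖² ≤ ‖T u'‖ ‖T u‖` for the form root `T`, and smoothing controls `t
‖T u'(t)‖` by `‖T u(t/2)‖`. The bound is by energies, which are integrable in time. -/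
theorem sq_mul_norm_deriv_sq_le (he : Orthonormal 𝕜 e) (hlam : ∀ i, 0 ≤ lam i)
    (hu : IsWeakHeat (formRoot (𝕜 := 𝕜) e lam) u) {t : ℝ} (ht : 0 < t) :
    t ^ 2 * ‖deriv u t‖ ^ 2 ≤ t * (‖formRoot e lam ⟨u (t / 2), hu.mem (t / 2) (half_pos ht)⟩‖ ^ 2
      + ‖formRoot e lam ⟨u t, hu.mem t ht⟩‖ ^ 2) := by
  have h1 := hu.weak t ht ⟨deriv u t, deriv_mem_formDomain he hlam hu ht⟩
  have h2 := sq_mul_norm_formRoot_deriv_sq_le he hlam hu ht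
  have h3 := congrArg RCLike.re h1
  rw [map_add, map_zero, inner_self_eq_norm_sq] at h3
  have h4 := re_inner_le_norm (𝕜 := 𝕜)
    (-formRoot e lam ⟨deriv u t, deriv_mem_formDomain he hlam hu ht⟩)
    (formRoot e lam ⟨u t, hu.mem t ht⟩)
  rw [inner_neg_left, map_neg, norm_neg] at h4
  change ‖deriv u t‖ ^ 2 + _ = 0 at h3
  set a := ‖formRoot e lam ⟨deriv u t, deriv_mem_formDomain he hlam hu ht⟩‖
  set b := ‖formRoot e lam ⟨u t, hu.mem t ht⟩‖
  have h5 : ‖deriv u t‖ ^ 2 ≤ a * b := by linarith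
  calc t ^ 2 * ‖deriv u t‖ ^ 2 ≤ t ^ 2 * (a * b) := by gcongr
    _ = t * (t * a * b) := by ring
    _ ≤ t * (t ^ 2 * a ^ 2 + b ^ 2) := by
        gcongr
        nlinarith [sq_nonneg (t * a - b), sq_nonneg (t * a), sq_nonneg b]
    _ ≤ _ := by gcongr

end HeatBounds

section ErrorEstimate

open Set intervalIntegral

/-! ### The abstract error estimate -/

variable {𝕜 : Type*} [RCLike 𝕜] {H : Type*} [NormedAddCommGroup H] [InnerProductSpace 𝕜 H]
  [NormedSpace ℝ H] [IsScalarTower ℝ 𝕜 H]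
  {ι : Type*} {e : ι → H} {lam : ι → ℝ} {u : ℝ → H} {S : Submodule 𝕜 H} [FiniteDimensional 𝕜 S]

/-- The derivative of the projection of `u'` onto a finite-dimensional subspace of the form
domain. -/
theorem exists_hasDerivAt_projection_deriv (he : Orthonormal 𝕜 e) (hlam : ∀ i, 0 ≤ lam i)
    (hu : IsWeakHeat (formRoot (𝕜 := 𝕜) e lam) u) (hS : S ≤ formDomain e lam)
    {t : ℝ} (ht : 0 < t) :
    ∃ d : S, HasDerivAt (fun s => S.orthogonalProjectionOnto (deriv u s)) d t ∧
      ∀ χ : S, inner 𝕜 χ d = -inner 𝕜 (formRoot e lam (Submodule.inclusion hS χ))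
        (formRoot e lam ⟨deriv u t, deriv_mem_formDomain he hlam hu ht⟩) := by
  let b := stdOrthonormalBasis 𝕜 S
  have h1 (χ : S) : HasDerivAt (fun s => inner 𝕜 χ (S.orthogonalProjectionOnto (deriv u s)))
      (-inner 𝕜 (formRoot e lam (Submodule.inclusion hS χ))
        (formRoot e lam ⟨deriv u t, deriv_mem_formDomain he hlam hu ht⟩)) t := by
    simp only [Submodule.inner_orthogonalProjectionOnto_eq_of_mem_left]
    exact hasDerivAt_inner_deriv he hlam hu ht (Submodule.inclusion hS χ)
  have h2 : HasDerivAt (fun s => S.orthogonalProjectionOnto (deriv u s))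
      (∑ j, (-inner 𝕜 (formRoot e lam (Submodule.inclusion hS (b j)))
        (formRoot e lam ⟨deriv u t, deriv_mem_formDomain he hlam hu ht⟩)) • b j) t := by
    have h3 : (fun s => S.orthogonalProjectionOnto (deriv u s)) =
        fun s => ∑ j, inner 𝕜 (b j) (S.orthogonalProjectionOnto (deriv u s)) • b j := by
      ext1 s
      exact (b.sum_repr' _).symm
    rw [h3]
    refine HasDerivAt.fun_sum fun j _ => ?_
    exact (h1 (b j)).smul_const (b j)
  refine ⟨_, h2, fun χ => ?_⟩
  have h4 := (hasDerivAt_const t χ).inner 𝕜 h2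
  rw [inner_zero_left, add_zero] at h4
  exact h4.unique (h1 χ)

/-- The error of the semidiscrete solution of the heat equation for a diagonal operator in a
finite-dimensional subspace, in terms of the error of the Ritz projection. -/
theorem semidiscrete_error [CompleteSpace H] (he : Orthonormal 𝕜 e) (hlam : ∀ i, 0 ≤ lam i)
    (hu : IsWeakHeat (formRoot (𝕜 := 𝕜) e lam) u) (huc : ContinuousOn u (Ici 0))
    (hS : S ≤ formDomain e lam) {uh : ℝ → H} (huhc : ContinuousOn uh (Ici 0))
    (huhS : ∀ t, 0 ≤ t → uh t ∈ S) (huhd : ∀ t, 0 < t → DifferentiableAt ℝ uh t)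
    (huhw : ∀ t (ht : 0 < t) (χ : S), inner 𝕜 (χ : H) (deriv uh t)
      + inner 𝕜 (formRoot e lam (Submodule.inclusion hS χ))
        (formRoot e lam ⟨uh t, hS (huhS t ht.le)⟩) = 0)
    (huh0 : ∀ χ : S, inner 𝕜 (χ : H) (uh 0) = inner 𝕜 (χ : H) (u 0))
    {ρ : ℝ → H} {w : ℝ → S} (hρ : ∀ t, 0 < t → ρ t = w t - u t)
    (hw : ∀ t (ht : 0 < t) (χ : S),
      inner 𝕜 (formRoot e lam (Submodule.inclusion hS χ))
        (formRoot e lam (Submodule.inclusion hS (w t))) + inner 𝕜 (χ : H) (w t : H) =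
      inner 𝕜 (formRoot e lam (Submodule.inclusion hS χ)) (formRoot e lam ⟨u t, hu.mem t ht⟩)
        + inner 𝕜 (χ : H) (u t))
    {T : ℝ} :
    (∀ s, 0 < s → DifferentiableAt ℝ ρ s) ∧
    ∀ t, 0 < t → t ≤ T →
      IntervalIntegrable (fun s => s ^ 2 * ‖deriv ρ s‖ ^ 2 + ‖ρ s‖ ^ 2) volume 0 t ∧
      ‖uh t - u t‖ ^ 2 ≤ 2 * ((3 + T) * (2 + 2 * T ^ 2) + T + 1) *
        (‖ρ t‖ ^ 2 + t⁻¹ * ∫ s in (0 : ℝ)..t, (s ^ 2 * ‖deriv ρ s‖ ^ 2 + ‖ρ s‖ ^ 2)) := by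
  have : CompleteSpace S := FiniteDimensional.complete 𝕜 S
  obtain ⟨A, L, hA, hAi, hLl, hLr⟩ := exists_ritz_operator (formRoot e lam) hS
  let P : H →L[𝕜] S := S.orthogonalProjectionOnto
  have hPi (χ : S) (v : H) : inner 𝕜 χ (P v) = inner 𝕜 (χ : H) v :=
    Submodule.inner_orthogonalProjectionOnto_eq_of_mem_left _ _
  have hPn (v : H) : ‖P v‖ ≤ ‖v‖ := S.norm_orthogonalProjectionOnto_apply_le v
  have hPd {f : ℝ → H} {f' : H} {s : ℝ} (hf : HasDerivAt f f' s) :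
      HasDerivAt (fun r => P (f r)) (P f') s :=
    (P.restrictScalars ℝ).hasFDerivAt.comp_hasDerivAt s hf
  -- Since `a(u, χ) = −⟨u', χ⟩`, the Ritz projection of `u` solves `(1 + A) w = P (u − u')`. This
  -- formula makes `w` differentiable in time.
  have hwL {t : ℝ} (ht : 0 < t) : w t = L (P (u t) - P (deriv u t)) := by
    rw [← hLl (w t)]
    congr 1
    refine ext_inner_left 𝕜 fun χ => ?_
    rw [inner_add_right, inner_sub_right, hAi, hPi, hPi]
    have h1 := hu.weak t ht (Submodule.inclusion hS χ)
    have h2 := hw t ht χ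
    rw [Submodule.coe_inner]
    simp only [Submodule.coe_inclusion] at h1
    linear_combination h2 + h1
  choose d hd hdi using fun (t : ℝ) (ht : 0 < t) =>
    exists_hasDerivAt_projection_deriv he hlam hu hS ht
  have hw' (t : ℝ) (ht : 0 < t) : HasDerivAt w (L (P (deriv u t) - d t ht)) t := by
    have h1 : HasDerivAt (fun s => P (u s) - P (deriv u s)) (P (deriv u t) - d t ht) t :=
      (hPd (hu.differentiableAt t ht).hasDerivAt).sub (hd t ht)
    have h2 : HasDerivAt (fun s => L (P (u s) - P (deriv u s))) (L (P (deriv u t) - d t ht)) t :=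
      (L.restrictScalars ℝ).hasFDerivAt.comp_hasDerivAt t h1
    exact h2.congr_of_eventuallyEq
      (Filter.mem_of_superset (Ioi_mem_nhds ht) fun s hs => hwL hs)
  have hwn (t : ℝ) (ht : 0 < t) :
      ‖w t‖ ^ 2 ≤ ‖u t‖ ^ 2 + ‖formRoot e lam ⟨u t, hu.mem t ht⟩‖ ^ 2 := by
    refine norm_sq_le_of_ritz (formRoot e lam) (Submodule.inclusion hS (w t)) ⟨u t, hu.mem t ht⟩ ?_
    have := hw t ht (w t)
    simp only [Submodule.coe_inclusion]
    linear_combination this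
  -- `w'` is the Ritz projection of `u'`, so the same stability bound applies.
  have hw'n (t : ℝ) (ht : 0 < t) : ‖deriv w t‖ ^ 2 ≤ ‖deriv u t‖ ^ 2
      + ‖formRoot e lam ⟨deriv u t, deriv_mem_formDomain he hlam hu ht⟩‖ ^ 2 := by
    rw [(hw' t ht).deriv]
    set w1 := L (P (deriv u t) - d t ht) with hw1
    refine norm_sq_le_of_ritz (formRoot e lam) (Submodule.inclusion hS w1)
      ⟨deriv u t, deriv_mem_formDomain he hlam hu ht⟩ ?_
    have h1 := congrArg (fun y => inner 𝕜 w1 y) (hLr (P (deriv u t) - d t ht))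
    simp only [← hw1, inner_add_right, inner_sub_right, hAi, hPi, hdi] at h1
    simp only [Submodule.coe_inclusion]
    rw [Submodule.coe_inner] at h1
    linear_combination h1
  have hρ' (t : ℝ) (ht : 0 < t) : HasDerivAt ρ (((deriv w t : S) : H) - deriv u t) t := by
    have h1 : HasDerivAt (fun s => (w s : H)) ((deriv w t : S) : H) t := by
      have := (S.subtypeL.restrictScalars ℝ).hasFDerivAt.comp_hasDerivAt t
        (hw' t ht).differentiableAt.hasDerivAt
      exact this
    exact (h1.sub (hu.differentiableAt t ht).hasDerivAt).congr_of_eventuallyEq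
      (Filter.mem_of_superset (Ioi_mem_nhds ht) fun s hs => hρ s hs)
  refine ⟨fun s hs => (hρ' s hs).differentiableAt, fun t ht htT => ?_⟩
  -- The energy `a(u, u)`, written so that it makes sense at every `s` without a membership proof.
  let E (s : ℝ) : ℝ := -RCLike.re (inner 𝕜 (u s) (deriv u s))
  have hE {s : ℝ} (hs : 0 < s) : ‖formRoot e lam ⟨u s, hu.mem s hs⟩‖ ^ 2 = E s := by
    simp only [E, hu.re_inner_deriv hs, neg_neg]
  have hEi : IntervalIntegrable E volume 0 t := hu.intervalIntegrable_energy huc ht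
  have hEi2 : IntervalIntegrable (fun s => E (s / 2)) volume 0 t := by
    have h := (hu.intervalIntegrable_energy huc (half_pos ht)).comp_mul_right (c := 1 / 2)
    have h' : IntervalIntegrable (fun s => E (s * (1 / 2))) volume (0 / (1 / 2)) (t / 2 / (1 / 2)) :=
      h
    simpa [div_eq_mul_inv] using h'
  have hsq {f : ℝ → H} (hf : ContinuousOn f (Ici 0)) :
      IntervalIntegrable (fun s => ‖f s‖ ^ 2) volume 0 t := by
    refine ContinuousOn.intervalIntegrable ?_
    rw [uIcc_of_le ht.le]
    exact (hf.mono Icc_subset_Ici_self).norm.pow 2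
  have hwc : ContinuousOn w (Ioi 0) := fun s hs => (hw' s hs).continuousAt.continuousWithinAt
  have hρc : ContinuousOn ρ (Ioi 0) := fun s hs => (hρ' s hs).continuousAt.continuousWithinAt
  have hwi : IntervalIntegrable (fun s => ‖w s‖ ^ 2) volume 0 t := by
    refine intervalIntegrable_of_le_on_Ioc
      (aestronglyMeasurable_uIoc_of_continuousOn_Ioi (hwc.norm.pow 2) ht) ht
      ((hsq huc).add hEi) fun s hs => ?_
    rw [Real.norm_of_nonneg (by positivity)]
    exact (hwn s hs.1).trans_eq (by rw [hE hs.1])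
  have hρi : IntervalIntegrable (fun s => ‖ρ s‖ ^ 2) volume 0 t := by
    refine intervalIntegrable_of_le_on_Ioc
      (aestronglyMeasurable_uIoc_of_continuousOn_Ioi (hρc.norm.pow 2) ht) ht
      ((hwi.const_mul 2).add ((hsq huc).const_mul 2)) fun s hs => ?_
    rw [Real.norm_of_nonneg (by positivity), hρ s hs.1]
    have h1 := norm_sub_le (w s : H) (u s)
    have h2 : ‖(w s : H)‖ = ‖w s‖ := rfl
    rw [h2] at h1
    nlinarith [norm_nonneg ((w s : H) - u s), sq_nonneg (‖w s‖ - ‖u s‖)]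
  -- Stability of `w'` leaves `4 s² ‖u'‖²` plus twice `s²` times the energy of `u'`; both are
  -- bounded by `E(s)` and `E(s/2)`.
  have hρ'i : IntervalIntegrable (fun s => s ^ 2 * ‖deriv ρ s‖ ^ 2) volume 0 t := by
    have hm : AEStronglyMeasurable (fun s => s ^ 2 * ‖deriv ρ s‖ ^ 2)
        (volume.restrict (uIoc 0 t)) :=
      ((continuous_pow 2).aestronglyMeasurable).mul
        ((aestronglyMeasurable_deriv ρ _).norm.pow 2)
    refine intervalIntegrable_of_le_on_Ioc hm ht
      (((hEi2.add hEi).const_mul (4 * t)).add (hEi2.const_mul 2)) fun s hs => ?_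
    have hs0 := hs.1
    rw [Real.norm_of_nonneg (by positivity), (hρ' s hs0).deriv]
    have h1 := norm_sub_le ((deriv w s : S) : H) (deriv u s)
    have h2 : ‖((deriv w s : S) : H)‖ = ‖deriv w s‖ := rfl
    rw [h2] at h1
    have h3 : ‖((deriv w s : S) : H) - deriv u s‖ ^ 2 ≤ 2 * ‖deriv w s‖ ^ 2 + 2 * ‖deriv u s‖ ^ 2 := by
      nlinarith [norm_nonneg (((deriv w s : S) : H) - deriv u s),
        sq_nonneg (‖deriv w s‖ - ‖deriv u s‖)]
    have h4 := hw'n s hs0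
    have h5 := sq_mul_norm_deriv_sq_le he hlam hu hs0
    have h6 := sq_mul_norm_formRoot_deriv_sq_le he hlam hu hs0
    rw [hE hs0, hE (half_pos hs0)] at h5
    rw [hE (half_pos hs0)] at h6
    have h7 : 0 ≤ E (s / 2) + E s := by
      rw [← hE hs0, ← hE (half_pos hs0)]; positivity
    have h8 : s * (E (s / 2) + E s) ≤ t * (E (s / 2) + E s) := by gcongr; exact hs.2
    have h9 := mul_le_mul_of_nonneg_left (h3.trans (add_le_add_left (mul_le_mul_of_nonneg_left h4
      zero_le_two) _)) (sq_nonneg s)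
    linarith
  have hsum := hρ'i.add hρi
  refine ⟨hsum, ?_⟩
  -- Applying `P` to `uh s`, which it fixes for `s ≥ 0`, gives an `S`-valued function on all of `ℝ`.
  let θ (s : ℝ) : S := P (uh s) - w s
  let g (s : ℝ) : S := P (ρ s)
  have hg' (s : ℝ) (hs : 0 < s) : HasDerivAt g (P (deriv ρ s)) s :=
    hPd (hρ' s hs).differentiableAt.hasDerivAt
  have hθ' (s : ℝ) (hs : 0 < s) : HasDerivAt θ (P (deriv uh s) - deriv w s) s :=
    (hPd (huhd s hs).hasDerivAt).sub (hw' s hs).differentiableAt.hasDerivAt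
  have hPS (v : S) : P (v : H) = v := S.orthogonalProjectionOnto_mem_subspace_eq_self v
  have hPuh {s : ℝ} (hs : 0 ≤ s) : ((P (uh s) : S) : H) = uh s :=
    congrArg Subtype.val (hPS ⟨uh s, huhS s hs⟩)
  have hθc : ContinuousOn θ (Ioi 0) := fun s hs => (hθ' s hs).continuousAt.continuousWithinAt
  have hgc : ContinuousOn g (Ioi 0) := fun s hs => (hg' s hs).continuousAt.continuousWithinAt
  have hθle (s : ℝ) : ‖θ s‖ ^ 2 ≤ 2 * ‖uh s‖ ^ 2 + 2 * ‖w s‖ ^ 2 := by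
    have h1 := norm_sub_le (P (uh s)) (w s)
    have h2 := hPn (uh s)
    have h3 : ‖θ s‖ ≤ ‖uh s‖ + ‖w s‖ := by simp only [θ]; linarith
    nlinarith [norm_nonneg (θ s), sq_nonneg (‖uh s‖ - ‖w s‖)]
  have hθi : IntervalIntegrable (fun s => ‖θ s‖ ^ 2) volume 0 t := by
    refine intervalIntegrable_of_le_on_Ioc
      (aestronglyMeasurable_uIoc_of_continuousOn_Ioi (hθc.norm.pow 2) ht) ht
      (((hsq huhc).const_mul 2).add (hwi.const_mul 2)) fun s _ => ?_
    rw [Real.norm_of_nonneg (by positivity)]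
    exact hθle s
  have hgle (s : ℝ) : ‖g s‖ ^ 2 ≤ ‖ρ s‖ ^ 2 := by
    have := hPn (ρ s)
    gcongr
  have hg'le {s : ℝ} (hs : 0 < s) : s ^ 2 * ‖deriv g s‖ ^ 2 ≤ s ^ 2 * ‖deriv ρ s‖ ^ 2 := by
    have := hPn (deriv ρ s)
    rw [(hg' s hs).deriv]
    gcongr
  have hgi : IntervalIntegrable (fun s => ‖g s‖ ^ 2) volume 0 t :=
    intervalIntegrable_of_le_on_Ioc
      (aestronglyMeasurable_uIoc_of_continuousOn_Ioi (hgc.norm.pow 2) ht) ht hρi fun s _ => by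
        rw [Real.norm_of_nonneg (by positivity)]
        exact hgle s
  have hg'i : IntervalIntegrable (fun s => s ^ 2 * ‖deriv g s‖ ^ 2) volume 0 t := by
    have hm : AEStronglyMeasurable (fun s => s ^ 2 * ‖deriv g s‖ ^ 2)
        (volume.restrict (uIoc 0 t)) :=
      ((continuous_pow 2).aestronglyMeasurable).mul
        ((aestronglyMeasurable_deriv g _).norm.pow 2)
    refine intervalIntegrable_of_le_on_Ioc hm ht hρ'i fun s hs => ?_
    rw [Real.norm_of_nonneg (by positivity)]
    exact hg'le hs.1
  -- `u` and `uh` are bounded on `[0, t]`, and the energy part of the Ritz bound costs exactly one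
  -- factor `s` by smoothing.
  have hθb : ∃ M, ∀ s ∈ Ioc 0 t, s * ‖θ s‖ ^ 2 ≤ M := by
    obtain ⟨M₁, hM₁⟩ := isCompact_Icc.exists_bound_of_continuousOn
      (huc.mono (Icc_subset_Ici_self : Icc 0 t ⊆ Ici 0))
    obtain ⟨M₂, hM₂⟩ := isCompact_Icc.exists_bound_of_continuousOn
      (huhc.mono (Icc_subset_Ici_self : Icc 0 t ⊆ Ici 0))
    refine ⟨t * (2 * M₂ ^ 2 + 2 * M₁ ^ 2) + 2 * M₁ ^ 2, fun s hs => ?_⟩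
    have h1 := hM₁ s ⟨hs.1.le, hs.2⟩
    have h2 := hM₁ (s / 2) ⟨(half_pos hs.1).le, (half_le_self hs.1.le).trans hs.2⟩
    have h3 := hM₂ s ⟨hs.1.le, hs.2⟩
    have h4 := mul_norm_formRoot_sq_le he hlam hu hs.1
    have h5 : ‖u s‖ ^ 2 ≤ M₁ ^ 2 := by gcongr
    have h6 : ‖u (s / 2)‖ ^ 2 ≤ M₁ ^ 2 := by gcongr
    have h7 : ‖uh s‖ ^ 2 ≤ M₂ ^ 2 := by gcongr
    have h8 : ‖θ s‖ ^ 2 ≤ 2 * M₂ ^ 2 + 2 * M₁ ^ 2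
        + 2 * ‖formRoot e lam ⟨u s, hu.mem s hs.1⟩‖ ^ 2 := by
      linarith [hθle s, hwn s hs.1]
    have h9 := mul_le_mul_of_nonneg_left h8 hs.1.le
    have h10 := mul_le_mul_of_nonneg_right hs.2
      (by positivity : 0 ≤ 2 * M₂ ^ 2 + 2 * M₁ ^ 2)
    linarith
  have hmain := mul_norm_sq_le_of_energy (z := fun s => P (uh s - u s)) hA ht htT
    (fun s hs => (hθ' s hs).differentiableAt) (fun s hs => (hg' s hs).differentiableAt)
    (P.continuous.comp_continuousOn (huhc.sub huc)) ?_ ?_ ?_ hθi hgi hg'i hθb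
  · have hK : 0 ≤ (3 + T) * (2 + 2 * T ^ 2) + T := by
      have : 0 < T := ht.trans_le htT
      positivity
    set K := (3 + T) * (2 + 2 * T ^ 2) + T
    have hI1 : ∫ s in (0 : ℝ)..t, s ^ 2 * ‖deriv g s‖ ^ 2 ≤
        ∫ s in (0 : ℝ)..t, s ^ 2 * ‖deriv ρ s‖ ^ 2 := by
      refine integral_mono_on ht.le hg'i hρ'i fun s hs => ?_
      rcases hs.1.eq_or_lt with rfl | h0
      · simp
      · exact hg'le h0
    have hI2 : ∫ s in (0 : ℝ)..t, ‖g s‖ ^ 2 ≤ ∫ s in (0 : ℝ)..t, ‖ρ s‖ ^ 2 :=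
      integral_mono_on ht.le hgi hρi fun s _ => hgle s
    have hJ1 : 0 ≤ ∫ s in (0 : ℝ)..t, s ^ 2 * ‖deriv ρ s‖ ^ 2 :=
      integral_nonneg ht.le fun s _ => by positivity
    have hJ2 : 0 ≤ ∫ s in (0 : ℝ)..t, ‖ρ s‖ ^ 2 := integral_nonneg ht.le fun s _ => by positivity
    rw [integral_add hρ'i hρi]
    set J₁ := ∫ s in (0 : ℝ)..t, s ^ 2 * ‖deriv ρ s‖ ^ 2
    set J₂ := ∫ s in (0 : ℝ)..t, ‖ρ s‖ ^ 2
    -- The derivative term has coefficient `1` and the other `K`; `K + 1` covers both. The final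
    -- factor `2` comes from squaring `e = θ + ρ`.
    have h1 : t * ‖θ t‖ ^ 2 ≤ (K + 1) * (J₁ + J₂) := by
      have := mul_le_mul_of_nonneg_left hI2 hK
      nlinarith [mul_nonneg hK hJ1]
    have h2 : ‖θ t‖ ^ 2 ≤ (K + 1) * (t⁻¹ * (J₁ + J₂)) := by
      have : ‖θ t‖ ^ 2 = t⁻¹ * (t * ‖θ t‖ ^ 2) := by field_simp
      rw [this]
      calc t⁻¹ * (t * ‖θ t‖ ^ 2) ≤ t⁻¹ * ((K + 1) * (J₁ + J₂)) := by gcongr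
        _ = _ := by ring
    have h3 : uh t - u t = (θ t : H) + ρ t := by
      rw [hρ t ht]
      simp only [θ, Submodule.coe_sub, hPuh ht.le]
      abel
    have h4 := norm_add_le (θ t : H) (ρ t)
    have h5 : ‖(θ t : H)‖ = ‖θ t‖ := rfl
    rw [← h3, h5] at h4
    nlinarith [norm_nonneg (uh t - u t), sq_nonneg (‖θ t‖ - ‖ρ t‖),
      mul_nonneg hK (sq_nonneg ‖ρ t‖)]
  · refine ext_inner_left 𝕜 fun χ => ?_
    rw [hPi, inner_sub_right, huh0, sub_self, inner_zero_right]
  · intro s hs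
    simp only [θ, g, hρ s hs, map_sub, hPS]
    abel
  -- The error equation: in the difference of the two weak equations, the Ritz identity turns `a(ρ,
  -- χ)` into `−⟨ρ, χ⟩`.
  · intro s hs
    refine (hPd ((huhd s hs).hasDerivAt.sub (hu.differentiableAt s hs).hasDerivAt)).congr_deriv ?_
    refine ext_inner_left 𝕜 fun χ => ?_
    have h1 := hu.weak s hs (Submodule.inclusion hS χ)
    have h2 := huhw s hs χ
    have h3 := hw s hs χ
    have h4 : Submodule.inclusion hS (P (uh s)) = ⟨uh s, hS (huhS s hs.le)⟩ :=
      Subtype.ext (hPuh hs.le)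
    simp only [Submodule.coe_inclusion] at h1
    simp only [g, θ, hρ s hs, inner_sub_right, map_sub, hPi, hPS, hAi, h4]
    rw [Submodule.coe_inner]
    linear_combination h2 - h1 - h3

end ErrorEstimate

section Sphere

/-! ### Application to the sphere -/

variable {𝕜 : Type*} [RCLike 𝕜] {n : ℕ} (B : HarmonicBasis 𝕜 n)

/-- The spherical harmonics of all degrees, as elements of `L₂`. -/
def harmVec (i : Σ l, Fin (harmDim 𝕜 n l)) : L2 𝕜 n :=
  ContinuousMap.toLp 2 (surf n) 𝕜 (B.Y i.1 i.2)

variable (𝕜 n) in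
/-- The eigenvalue belonging to each spherical harmonic. -/
def harmEig (i : Σ l, Fin (harmDim 𝕜 n l)) : ℝ := eig n i.1

theorem harmEig_nonneg (i : Σ l, Fin (harmDim 𝕜 n l)) : 0 ≤ harmEig 𝕜 n i := eig_nonneg i.1

theorem orthonormal_harmVec (hn : 1 ≤ n) : Orthonormal 𝕜 (harmVec B) := by
  classical
  rw [orthonormal_iff_ite]
  rintro ⟨l, k⟩ ⟨m, j⟩
  rw [harmVec, harmVec, ContinuousMap.inner_toLp]
  by_cases hlm : l = m
  · subst hlm
    refine (B.orthonormal l j k).trans ?_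
    simp [eq_comm]
  · rw [if_neg (by rintro ⟨⟩; exact hlm rfl)]
    exact integral_sphHarm_mul_conj hn (Ne.symm hlm) (B.mem m j) (B.mem l k)

theorem coeff_eq_inner (v : L2 𝕜 n) (l : ℕ) (k : Fin (harmDim 𝕜 n l)) :
    coeff B v l k = inner 𝕜 (harmVec B ⟨l, k⟩) v := rfl

theorem coeffA_eq (v : L2 𝕜 n) (l : ℕ) (k : Fin (harmDim 𝕜 n l)) :
    coeffA B v l k = ((eig n l : ℝ) : 𝕜) * inner 𝕜 (harmVec B ⟨l, k⟩) v := by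
  rw [coeffA, harmVec, L2.inner_def, ← integral_const_mul]
  refine integral_congr_ae ?_
  filter_upwards [ContinuousMap.coeFn_toLp (p := 2) (𝕜 := 𝕜) (surf n) (B.Y l k)] with x hx
  rw [hx, lapBeltrami_of_mem_sphHarm (B.mem l k), RCLike.inner_apply]
  simp
  ring

/-- The weights `1 + λ_l` and `λ_l` differ by the sum of squared coefficients, which converges by
Bessel's inequality. -/
theorem H1_eq_formDomain (hn : 1 ≤ n) : H1 B = formDomain (harmVec B) (harmEig 𝕜 n) := by
  ext v
  rw [mem_formDomain_iff harmEig_nonneg]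
  have hB := (orthonormal_harmVec B hn).inner_products_summable v
  have key : v ∈ H1 B ↔ Summable fun i : Σ l, Fin (harmDim 𝕜 n l) =>
      (1 + harmEig 𝕜 n i) * ‖inner 𝕜 (harmVec B i) v‖ ^ 2 := by
    rw [summable_sigma_of_nonneg fun i => mul_nonneg
      (add_nonneg zero_le_one (harmEig_nonneg i)) (sq_nonneg _)]
    rw [and_iff_right fun l => (hasSum_fintype _).summable]
    simp only [tsum_fintype, harmEig, ← Finset.mul_sum]
    rfl
  rw [key]
  simp only [add_mul, one_mul]
  exact ⟨fun h => by simpa using h.sub hB, fun h => hB.add h⟩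

/-- The eigenvalue relation identifies the terms, and summability of the `ℓ²` inner product permits
regrouping them by degree. -/
theorem formA_eq_inner (hn : 1 ≤ n) (v w : H1 B) :
    formA B v w = inner 𝕜
      (formRoot (harmVec B) (harmEig 𝕜 n) ⟨w, (H1_eq_formDomain B hn).le w.2⟩)
      (formRoot (harmVec B) (harmEig 𝕜 n) ⟨v, (H1_eq_formDomain B hn).le v.2⟩) := by
  have hs := lp.summable_inner (𝕜 := 𝕜)
    (formRoot (harmVec B) (harmEig 𝕜 n) ⟨w, (H1_eq_formDomain B hn).le w.2⟩)
    (formRoot (harmVec B) (harmEig 𝕜 n) ⟨v, (H1_eq_formDomain B hn).le v.2⟩)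
  rw [lp.inner_eq_tsum, hs.tsum_sigma, formA]
  refine tsum_congr fun l => ?_
  rw [tsum_fintype]
  refine Finset.sum_congr rfl fun k _ => ?_
  have h : ((Real.sqrt (eig n l) : ℝ) : 𝕜) * ((Real.sqrt (eig n l) : ℝ) : 𝕜)
      = ((eig n l : ℝ) : 𝕜) := by
    rw [← RCLike.ofReal_mul, Real.mul_self_sqrt (eig_nonneg l)]
  simp only [coeffA_eq, coeff_eq_inner, formRoot, harmEig, LinearMap.coe_mk, AddHom.coe_mk,
    RCLike.inner_apply, map_mul, RCLike.conj_ofReal, inner_conj_symm]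
  rw [← h]
  ring

/-- The error estimate for the semidiscrete heat equation on the sphere, in an arbitrary
finite-dimensional subspace of `L₂`. Both the discrete solution and the Ritz projection take values
in `S ⊓ H¹`, which is the space the abstract estimate is applied to. -/
theorem semidiscrete_error_sphere (hn : 1 ≤ n) (S : Submodule 𝕜 (L2 𝕜 n))
    [FiniteDimensional 𝕜 S] {u₀ : L2 𝕜 n} {u uh : ℝ → L2 𝕜 n} (hu : IsHeatSolution B u₀ u)
    (huh : IsSemidiscreteSolution B S (S.starProjection u₀) uh) {T : ℝ} :
    (∀ s : ℝ, 0 < s → DifferentiableAt ℝ (rho B S u) s) ∧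
    ∀ t : ℝ, 0 < t → t ≤ T →
      IntervalIntegrable
        (fun s => s ^ 2 * ‖deriv (rho B S u) s‖ ^ 2 + ‖rho B S u s‖ ^ 2) volume 0 t ∧
      ‖uh t - u t‖ ^ 2 ≤ 2 * ((3 + T) * (2 + 2 * T ^ 2) + T + 1) *
        (‖rho B S u t‖ ^ 2
          + t⁻¹ * ∫ s in (0 : ℝ)..t,
              (s ^ 2 * ‖deriv (rho B S u) s‖ ^ 2 + ‖rho B S u s‖ ^ 2)) := by
  have hD := H1_eq_formDomain B hn
  let S' : Submodule 𝕜 (L2 𝕜 n) := S ⊓ H1 B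
  have : FiniteDimensional 𝕜 S' := Submodule.finiteDimensional_of_le inf_le_left
  have hS' : S' ≤ formDomain (harmVec B) (harmEig 𝕜 n) := inf_le_right.trans hD.le
  have hweak : IsWeakHeat (formRoot (𝕜 := 𝕜) (harmVec B) (harmEig 𝕜 n)) u :=
    { differentiableAt := hu.differentiableAt
      mem := fun t ht => hD.le (hu.mem_H1 t ht)
      weak := fun t ht v => by
        have h := hu.weak t ht ⟨v, hD.ge v.2⟩
        rwa [formA_eq_inner B hn] at h }
  have huhS (t : ℝ) (ht : 0 ≤ t) : uh t ∈ S' := by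
    rcases ht.eq_or_lt with rfl | ht
    -- Membership in `H¹` is only given for positive times; at `0` it follows by continuity, `S'`
    -- being closed.
    · have hcl : IsClosed (S' : Set (L2 𝕜 n)) := S'.closed_of_finiteDimensional
      have hlim : Filter.Tendsto uh (nhdsWithin 0 (Set.Ioi 0)) (nhds (uh 0)) :=
        (huh.continuousOn 0 Set.self_mem_Ici).mono_left (nhdsWithin_mono _ Set.Ioi_subset_Ici_self)
      exact hcl.mem_of_tendsto hlim (eventually_mem_nhdsWithin.mono fun s hs =>
        ⟨huh.mem s (le_of_lt hs), huh.mem_H1 s hs⟩)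
    · exact ⟨huh.mem t ht.le, huh.mem_H1 t ht⟩
  have hritz (v : H1 B) : ((ritz B S v : L2 𝕜 n) ∈ S) ∧
      ∀ χ : H1 B, (χ : L2 𝕜 n) ∈ S → formA1 B (ritz B S v) χ = formA1 B v χ := by
    -- The chosen Ritz projection is meaningful once a solution exists; both it and the test
    -- functions lie in `S ⊓ H¹`.
    refine Classical.epsilon_spec (p := fun w : H1 B => (w : L2 𝕜 n) ∈ S ∧
      ∀ χ : H1 B, (χ : L2 𝕜 n) ∈ S → formA1 B w χ = formA1 B v χ) ?_
    obtain ⟨w, hw⟩ := exists_ritz (formRoot (𝕜 := 𝕜) (harmVec B) (harmEig 𝕜 n)) hS'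
      ⟨v, hD.le v.2⟩
    refine ⟨⟨w, w.2.2⟩, w.2.1, fun χ hχ => ?_⟩
    rw [formA1, formA1, formA_eq_inner B hn, formA_eq_inner B hn]
    exact hw ⟨χ, hχ, χ.2⟩
  let w (t : ℝ) : S' := if ht : 0 < t then
    ⟨ritz B S ⟨u t, hu.mem_H1 t ht⟩, (hritz _).1, (ritz B S ⟨u t, hu.mem_H1 t ht⟩).2⟩ else 0
  have hw (t : ℝ) (ht : 0 < t) : w t = ⟨ritz B S ⟨u t, hu.mem_H1 t ht⟩, (hritz _).1,
    (ritz B S ⟨u t, hu.mem_H1 t ht⟩).2⟩ := dif_pos ht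
  refine semidiscrete_error (orthonormal_harmVec B hn) harmEig_nonneg hweak hu.continuousOn hS'
    huh.continuousOn huhS huh.differentiableAt (fun t ht χ => ?_) (fun χ => ?_) (w := w)
    (fun t ht => ?_) (fun t ht χ => ?_)
  · have h := huh.weak t ht ⟨χ, χ.2.2⟩ χ.2.1
    rwa [formA_eq_inner B hn] at h
  · rw [huh.initial, hu.initial]
    rw [← Submodule.inner_starProjection_left_eq_right,
      Submodule.starProjection_eq_self_iff.2 χ.2.1]
  · rw [rho, dif_pos (hu.mem_H1 t ht), hw t ht]
  · rw [hw t ht]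
    have h := (hritz ⟨u t, hu.mem_H1 t ht⟩).2 ⟨χ, χ.2.2⟩ χ.2.1
    rwa [formA1, formA1, formA_eq_inner B hn, formA_eq_inner B hn] at h

end Sphere

end SphereHeat

end

/-! ### The theorem, with an explicit constant. -/

open SphereHeat in
theorem mainTheorem6 (𝕜 : Type*) [RCLike 𝕜] (T : ℝ) (hT : 0 < T) :
    ∃ C : ℝ, 0 < C ∧
      ∀ (n : ℕ) (_ : 2 ≤ n) (B : HarmonicBasis 𝕜 n)
        (τ : ℝ) (_ : (n : ℝ) / 2 < τ) (φ : C(Set.Icc (-1 : ℝ) 1, ℝ)) (a : ℕ → ℝ)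
        (_ : IsKernel n τ φ a) (X : Finset (Sph n))
        (u₀ : L2 𝕜 n) (u : ℝ → L2 𝕜 n) (_ : IsHeatSolution B u₀ u)
        (uh : ℝ → L2 𝕜 n)
        (_ : IsSemidiscreteSolution B (srbfSpace 𝕜 φ X)
          ((srbfSpace 𝕜 φ X).starProjection u₀) uh),
        (∀ s : ℝ, 0 < s → DifferentiableAt ℝ (rho B (srbfSpace 𝕜 φ X) u) s) ∧
        ∀ t : ℝ, 0 < t → t ≤ T →
          IntervalIntegrable
            (fun s => s ^ 2 * ‖deriv (rho B (srbfSpace 𝕜 φ X) u) s‖ ^ 2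
              + ‖rho B (srbfSpace 𝕜 φ X) u s‖ ^ 2) volume 0 t ∧
          ‖uh t - u t‖ ^ 2 ≤
            C * (‖rho B (srbfSpace 𝕜 φ X) u t‖ ^ 2
              + t⁻¹ * ∫ s in (0 : ℝ)..t,
                  (s ^ 2 * ‖deriv (rho B (srbfSpace 𝕜 φ X) u) s‖ ^ 2
                    + ‖rho B (srbfSpace 𝕜 φ X) u s‖ ^ 2)) := by
  refine ⟨2 * ((3 + T) * (2 + 2 * T ^ 2) + T + 1), by positivity, ?_⟩
  intro n hn B τ _ φ a _ X u₀ u hu uh huh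
  exact semidiscrete_error_sphere B (one_le_two.trans hn) (srbfSpace 𝕜 φ X) hu huh
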